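/- **Setting.** Let $n\ge 1$, agents $\mathcal A=\{1,\dots,n\}$, rooms $\mathcal R=\{1,\dots,n\}$, valuations $v_{ij}\ge 0$, budgets $b_{ij}\in\mathbb R$ and a total rent $R_t\in\mathbb R$. An allocation is a pair $(\sigma,r)$ of a bijection $\sigma:\mathcal A\to\mathcal R$ and rents $r\in\mathbb R^{\mathcal R}$; agent $i$ has utility $u_{ij}(r)=v_{ij}-r_j$ for room $j$. $(\sigma,r)$ is envy-free with total rent $R_t$, written $(\sigma,r)\in EF(R_t)$, if $u_{i\sigma(i)}(r)\ge u_{ij}(r)$ for all $i,j$ and $\sum_j r_j=R_t$; it is in $EF_b(R_t)$ if moreover $r_{\sigma(i)}\le b_{i\sigma(i)}$ for all $i$. The envy graph $G_E(\sigma,r)$ on $\mathcal R$ has an edge $\sigma(i)\to j$ iff $u_{i\sigma(i)}(r)\le u_{ij}(r)$; $R(X)$ and $R^{-1}(X)$ are the sets of rooms reachable from, respectively able to reach, the set $X$ in $G_E$. The budget-aware graph $G_b(\sigma,r)$ has those edges $\sigma(i)\to j$ with moreover $r_j<b_{ij}$. Agent $i$ is tight if $r_{\sigma(i)}=b_{i\sigma(i)}$.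 **Algorithm.** The parameter is an objective: maximin, leximin or min-spread. Below, "move $(I,D)$" means: increase the rents in $I$ at unit rate and decrease those in $D$ at rate $|I|/|D|$ until the first positive time at which an edge enters $G_E$ or a room enters or leaves one of the sets in use (changes at the very onset of the motion take no time). 1. Take any $(\sigma,r)\in EF(R')$ for some $R'\in\mathbb R$. 2. For each strongly connected component $C$ of $G_E(\sigma,r)$, in any order, consider the sub-instance of the rooms in $C$ and the agents $i$ with $\sigma(i)\in C$. Take any envy-free allocation $(\rho,q)$ of it, of any total rent, and shift all of $q$ by a constant so that all budgets hold and some agent is tight. While every tight agent's room lies on a cycle of length at least two of $G_b(\rho,q)$: if there is no tight agent, increase all rents by $\min_i(b_{i\rho(i)}-q_{\rho(i)})$; otherwise choose such a simple cycle through the room of a tight agent and move each agent on it to the next room. Let $\mu_C$ be the final assignment. 3. Combine the $\mu_C$ into an assignment $\mu$, take any $r$ with $(\mu,r)\in EF(R_t)$, and put $l_j=-\infty$ and $w_j=b_{\mu^{-1}(j)j}$. From now on, $L_f=\{j:r_j=l_j\}=\varnothing$ and $U_f=\{j:r_j=w_j\}$. 4. (Bounds.) While $U=\{j:r_j>w_j\}\ne\varnothing$: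 if $I=\mathcal R\setminus(R^{-1}(U_f)\cup R^{-1}(U))$ is empty, return "No solution"; otherwise move $(I,R^{-1}(U))$. 5. (Fair rents.) With the resulting $r$: * *maximin*: with $M$ the set of rooms whose occupants have the smallest utility, while $R^{-1}(M)\cup R^{-1}(U_f)\ne\mathcal R$ and $R(L_f)\cap M=\varnothing$, move $(\mathcal R\setminus(R^{-1}(M)\cup R^{-1}(U_f)),\,R^{-1}(M))$. Return $(\mu,r)$. * *leximin*: keep a set $F$ of frozen rooms, initially empty, which are added to $L_f$ and to $U_f$, and let $M$ be the set of rooms outside $F$ whose occupants have the smallest utility among the rooms outside $F$. While $R^{-1}(M)\cup R^{-1}(U_f)\ne\mathcal R$: if $R(L_f)\cap M\neq\varnothing$, add this set to $F$; otherwise make the same move as for maximin. Return $(\mu,r)$. * *min-spread*: run the maximin loop; let $F$ be its final set $M$, add $F$ to $L_f$ and to $U_f$, and let $M$ now be the set of rooms outside $F$ whose occupants have the largest utility among the rooms outside $F$. While $R(L_f)\cup R(M)\ne\mathcal R$ and $R^{-1}(U_f)\cap M=\varnothing$, move $(R(M),\,\mathcal R\setminus(R(M)\cup R(L_f)))$.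 Return $(\mu,r)$. **Claim.** There is a polynomial $p$ such that, for every $n$, every instance, every objective and all choices made by the algorithm, the algorithm never gets stuck and halts after at most $p(n)$ steps, where each computation of an envy-free allocation and each pass through a loop counts as one step. If $EF_b(R_t)=\varnothing$, it returns "No solution". Otherwise it returns some $(\mu,r)\in EF_b(R_t)$, and * for the objective maximin, $(\mu,r)$ maximizes $\min_i u_{i\sigma(i)}$ over all $(\sigma,s)\in EF_b(R_t)$, all utilities being taken at the rents of the allocation concerned; * for the objective leximin, no $(\sigma,s)\in EF_b(R_t)$ has a lexicographically larger vector of utilities sorted in nondecreasing order; * for the objective min-spread, $(\mu,r)$ minimizes the absolute spread $\max_i u_{i\sigma(i)}-\min_i u_{i\sigma(i)}$ over $EF_b(R_t)$; moreover, if some allocation in $EF_b(R_t)$ has only positive utilities, then so has $(\mu,r)$, and it minimizes the relative spread $\max_i u_{i\sigma(i)}/\min_i u_{i\sigma(i)}$ among all such allocations. -/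

import Mathlib

open Set

noncomputable section

namespace RentDivision

section Allocations

variable {A R : Type*}

/-- Quasi-linear utility of agent `i` for room `j` at rents `r`. -/
def util (V : A → R → ℝ) (r : R → ℝ) (i : A) (j : R) : ℝ := V i j - r j

/-- The set of envy-free allocations `(σ, r)` of total rent `Rt`. -/
def EF [Fintype R] (V : A → R → ℝ) (Rt : ℝ) : Set ((A ≃ R) × (R → ℝ)) :=
  {p | (∀ i j, util V p.2 i j ≤ util V p.2 i (p.1 i)) ∧ ∑ j, p.2 j = Rt}

/-- The envy-free allocations of total rent `Rt` in which no agent pays more than its budget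
for the room it receives. -/
def EFb [Fintype R] (V b : A → R → ℝ) (Rt : ℝ) : Set ((A ≃ R) × (R → ℝ)) :=
  {p | p ∈ EF V Rt ∧ ∀ i, p.2 (p.1 i) ≤ b i (p.1 i)}

/-- Utility of agent `i` in the allocation `p`. -/
def utilOf (V : A → R → ℝ) (p : (A ≃ R) × (R → ℝ)) (i : A) : ℝ := util V p.2 i (p.1 i)

def minUtil (V : A → R → ℝ) (p : (A ≃ R) × (R → ℝ)) : ℝ := ⨅ i, utilOf V p i

def maxUtil (V : A → R → ℝ) (p : (A ≃ R) × (R → ℝ)) : ℝ := ⨆ i, utilOf V p i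

/-- The utilities of all agents, in nondecreasing order. -/
def sortedUtils [Fintype A] (V : A → R → ℝ) (p : (A ≃ R) × (R → ℝ)) : List ℝ :=
  (Finset.univ.val.map (utilOf V p)).sort (· ≤ ·)

/-- `p` lies in `S` and maximizes the minimum utility over `S`. -/
def IsMaximin (V : A → R → ℝ) (S : Set ((A ≃ R) × (R → ℝ))) (p : (A ≃ R) × (R → ℝ)) : Prop :=
  p ∈ S ∧ ∀ q ∈ S, minUtil V q ≤ minUtil V p

/-- `p` lies in `S` and no element of `S` has a lexicographically larger sorted utility vector. -/
def IsLeximin [Fintype A] (V : A → R → ℝ) (S : Set ((A ≃ R) × (R → ℝ)))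
    (p : (A ≃ R) × (R → ℝ)) : Prop :=
  p ∈ S ∧ ∀ q ∈ S, ¬ List.Lex (· < ·) (sortedUtils V p) (sortedUtils V q)

/-- `p` lies in `S` and minimizes the difference of the largest and smallest utility over `S`. -/
def IsMinAbsSpread (V : A → R → ℝ) (S : Set ((A ≃ R) × (R → ℝ)))
    (p : (A ≃ R) × (R → ℝ)) : Prop :=
  p ∈ S ∧ ∀ q ∈ S, maxUtil V p - minUtil V p ≤ maxUtil V q - minUtil V q

/-- `p` lies in `S` and minimizes the ratio of the largest to the smallest utility over `S`.
The ratio is a meaningful spread only if all utilities are positive, so the comparison is with the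
allocations of positive utilities, and `p` is one of them as soon as there is one. -/
def IsMinRelSpread (V : A → R → ℝ) (S : Set ((A ≃ R) × (R → ℝ)))
    (p : (A ≃ R) × (R → ℝ)) : Prop :=
  p ∈ S ∧ ∀ q ∈ S, 0 < minUtil V q →
    0 < minUtil V p ∧ maxUtil V p / minUtil V p ≤ maxUtil V q / minUtil V q

end Allocations

section Graphs

variable {A R : Type*}

/-- Edges of the envy graph on rooms: the agent in room `x` weakly envies the one in room `y`. -/
def EnvyEdge (V : A → R → ℝ) (σ : A ≃ R) (r : R → ℝ) (x y : R) : Prop :=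
  util V r (σ.symm x) x ≤ util V r (σ.symm x) y

/-- Rooms reachable from `X` in the envy graph. -/
def reachFrom (V : A → R → ℝ) (σ : A ≃ R) (r : R → ℝ) (X : Set R) : Set R :=
  {y | ∃ x ∈ X, Relation.ReflTransGen (EnvyEdge V σ r) x y}

/-- Rooms that can reach `X` in the envy graph. -/
def reachTo (V : A → R → ℝ) (σ : A ≃ R) (r : R → ℝ) (X : Set R) : Set R :=
  {x | ∃ y ∈ X, Relation.ReflTransGen (EnvyEdge V σ r) x y}

/-- The strongly connected components of the envy graph. -/
def components (V : A → R → ℝ) (σ : A ≃ R) (r : R → ℝ) : Set (Set R) :=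
  Set.range fun x => {y | Relation.ReflTransGen (EnvyEdge V σ r) x y ∧
    Relation.ReflTransGen (EnvyEdge V σ r) y x}

/-- Edges of the budget-aware envy graph. -/
def BudgetEdge (V b : A → R → ℝ) (σ : A ≃ R) (r : R → ℝ) (x y : R) : Prop :=
  util V r (σ.symm x) x ≤ util V r (σ.symm x) y ∧ r y < b (σ.symm x) y

/-- A (simple) cycle of the budget-aware envy graph, as the cyclic permutation that moves each of
its rooms to the next one and fixes all other rooms. -/
def IsBudgetCycle (V b : A → R → ℝ) (σ : A ≃ R) (r : R → ℝ) (c : Equiv.Perm R) : Prop :=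
  c.IsCycle ∧ ∀ x, c x ≠ x → BudgetEdge V b σ r x (c x)

end Graphs

section MaxRent

variable {A R : Type*}

/-- Agent `i` pays exactly its budget. -/
def Tight (b : A → R → ℝ) (σ : A ≃ R) (r : R → ℝ) (i : A) : Prop := r (σ i) = b i (σ i)

/-- Loop guard of the maximum-rent procedure: no tight agent is off all cycles. -/
def MaxRentGuard (V b : A → R → ℝ) (σ : A ≃ R) (r : R → ℝ) : Prop :=
  ¬ ∃ i, Tight b σ r i ∧ ¬ ∃ c, IsBudgetCycle V b σ r c ∧ c (σ i) ≠ σ i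

/-- One pass through the loop of the maximum-rent procedure. -/
inductive MaxRentStep (V b : A → R → ℝ) :
    (A ≃ R) × (R → ℝ) → (A ≃ R) × (R → ℝ) → Prop
  /-- Case 1: nobody is tight; raise all rents equally until somebody is. -/
  | raise (σ : A ≃ R) (r : R → ℝ) (Δ : ℝ) (hg : MaxRentGuard V b σ r)
      (ht : ¬ ∃ i, Tight b σ r i)
      (hΔ : IsLeast (Set.range fun i => b i (σ i) - r (σ i)) Δ) :
      MaxRentStep V b (σ, r) (σ, fun j => r j + Δ)
  /-- Case 2: move the agents along a cycle through the room of a tight agent. -/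
  | shuffle (σ : A ≃ R) (r : R → ℝ) (i : A) (c : Equiv.Perm R) (hg : MaxRentGuard V b σ r)
      (ht : Tight b σ r i) (hc : IsBudgetCycle V b σ r c) (hi : c (σ i) ≠ σ i) :
      MaxRentStep V b (σ, r) (σ.trans c, r)

end MaxRent

section RentMoves

variable {A R : Type*}

/-- Velocity of the rents: rooms in `I` rise at unit rate, rooms in `D` fall at rate `|I| / |D|`. -/
def velocity (I D : Set R) : R → ℝ := fun j =>
  I.indicator (fun _ => 1) j - D.indicator (fun _ => (I.ncard : ℝ) / (D.ncard : ℝ)) j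

/-- The rents move from `r` in direction `d`, and `t` is the time of the next event, an event being
a change of the observed data `obs`. Memberships that are lost at once when the motion sets in
(a room at its bound, a weak envy that the motion resolves) take no time: `t` is the first positive
time at which the data differ from what they were during the motion so far. -/
def NextEvent {κ : Type*} (obs : (R → ℝ) → κ) (r d : R → ℝ) (t : ℝ) : Prop :=
  0 < t ∧ (∀ s ∈ Ioo 0 t, ∀ s' ∈ Ioo 0 t, obs (r + s • d) = obs (r + s' • d)) ∧
    ∀ s ∈ Ioo 0 t, obs (r + s • d) ≠ obs (r + t • d)

/-- `r'` are the rents at the next event when rents in `I` rise and rents in `D` fall. -/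
def MoveRents {κ : Type*} (obs : (R → ℝ) → κ) (I D : Set R) (r r' : R → ℝ) : Prop :=
  ∃ t, NextEvent obs r (velocity I D) t ∧ r' = r + t • velocity I D

/-- Rooms strictly below their lower bound. -/
def tooLow (l : R → EReal) (r : R → ℝ) : Set R := {j | (r j : EReal) < l j}

/-- Rooms strictly above their upper bound. -/
def tooHigh (u : R → EReal) (r : R → ℝ) : Set R := {j | u j < (r j : EReal)}

/-- Rooms exactly at the bound `w`. -/
def atBound (w : R → EReal) (r : R → ℝ) : Set R := {j | (r j : EReal) = w j}

/-- The rooms outside `F` whose occupants have the smallest utility among those outside `F`. -/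
def poorest (V : A → R → ℝ) (σ : A ≃ R) (F : Set R) (r : R → ℝ) : Set R :=
  {j | j ∉ F ∧ ∀ k ∉ F, util V r (σ.symm j) j ≤ util V r (σ.symm k) k}

/-- The rooms outside `F` whose occupants have the largest utility among those outside `F`. -/
def richest (V : A → R → ℝ) (σ : A ≃ R) (F : Set R) (r : R → ℝ) : Set R :=
  {j | j ∉ F ∧ ∀ k ∉ F, util V r (σ.symm k) k ≤ util V r (σ.symm j) j}

/-! Bounds procedure. -/

def BoundsGuard (l u : R → EReal) (r : R → ℝ) : Prop := (tooLow l r ∪ tooHigh u r).Nonempty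

open Classical in
def boundsInc (V : A → R → ℝ) (l u : R → EReal) (σ : A ≃ R) (r : R → ℝ) : Set R :=
  if (tooLow l r).Nonempty then reachFrom V σ r (tooLow l r)
  else (reachTo V σ r (atBound u r) ∪ reachTo V σ r (tooHigh u r))ᶜ

open Classical in
def boundsDec (V : A → R → ℝ) (l u : R → EReal) (σ : A ≃ R) (r : R → ℝ) : Set R :=
  if (tooHigh u r).Nonempty then reachTo V σ r (tooHigh u r)
  else (reachFrom V σ r (atBound l r) ∪ reachFrom V σ r (tooLow l r))ᶜ

/-- The test for "No solution". It includes the case that there is no room whose rent can be moved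
to compensate for the rooms whose rents have to move. -/
def BoundsFail (V : A → R → ℝ) (l u : R → EReal) (σ : A ≃ R) (r : R → ℝ) : Prop :=
  (tooHigh u r ∩ (reachFrom V σ r (atBound l r) ∪ reachFrom V σ r (tooLow l r))).Nonempty ∨
  (tooLow l r ∩ (reachTo V σ r (atBound u r) ∪ reachTo V σ r (tooHigh u r))).Nonempty ∨
  boundsInc V l u σ r = ∅ ∨ boundsDec V l u σ r = ∅

def BoundsStep (V : A → R → ℝ) (l u : R → EReal) (σ : A ≃ R) (r r' : R → ℝ) : Prop :=
  BoundsGuard l u r ∧ ¬ BoundsFail V l u σ r ∧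
    MoveRents
      (fun q => (EnvyEdge V σ q, tooLow l q, tooHigh u q, atBound l q, atBound u q))
      (boundsInc V l u σ r) (boundsDec V l u σ r) r r'

/-! Raising the minimum utility. The rents of the rooms in `F` are frozen: these rooms count as being
at both bounds, and the minimum is taken over the other rooms. -/

def RaiseMinGuard (V : A → R → ℝ) (u : R → EReal) (σ : A ≃ R) (F : Set R) (r : R → ℝ) : Prop :=
  reachTo V σ r (poorest V σ F r) ∪ reachTo V σ r (atBound u r ∪ F) ≠ univ

/-- The poorest rooms that cannot get cheaper because of a lower bound (or a frozen rent). -/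
def blockedPoorest (V : A → R → ℝ) (l : R → EReal) (σ : A ≃ R) (F : Set R) (r : R → ℝ) : Set R :=
  reachFrom V σ r (atBound l r ∪ F) ∩ poorest V σ F r

def RaiseMinStep (V : A → R → ℝ) (l u : R → EReal) (σ : A ≃ R) (F : Set R) (r r' : R → ℝ) :
    Prop :=
  RaiseMinGuard V u σ F r ∧ blockedPoorest V l σ F r = ∅ ∧
    MoveRents
      (fun q => (EnvyEdge V σ q, poorest V σ F q, atBound l q ∪ F, atBound u q ∪ F))
      (reachTo V σ r (poorest V σ F r) ∪ reachTo V σ r (atBound u r ∪ F))ᶜ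
      (reachTo V σ r (poorest V σ F r)) r r'

/-! Lowering the maximum utility, with the rents of the rooms in `F` frozen. -/

def LowerMaxGuard (V : A → R → ℝ) (l : R → EReal) (σ : A ≃ R) (F : Set R) (r : R → ℝ) : Prop :=
  reachFrom V σ r (atBound l r ∪ F) ∪ reachFrom V σ r (richest V σ F r) ≠ univ

/-- The richest rooms that cannot get more expensive. -/
def blockedRichest (V : A → R → ℝ) (u : R → EReal) (σ : A ≃ R) (F : Set R) (r : R → ℝ) : Set R :=
  reachTo V σ r (atBound u r ∪ F) ∩ richest V σ F r

def LowerMaxStep (V : A → R → ℝ) (l u : R → EReal) (σ : A ≃ R) (F : Set R) (r r' : R → ℝ) :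
    Prop :=
  LowerMaxGuard V l σ F r ∧ blockedRichest V u σ F r = ∅ ∧
    MoveRents
      (fun q => (EnvyEdge V σ q, richest V σ F q, atBound l q ∪ F, atBound u q ∪ F))
      (reachFrom V σ r (richest V σ F r))
      (reachFrom V σ r (richest V σ F r) ∪ reachFrom V σ r (atBound l r ∪ F))ᶜ r r'

end RentMoves

/-- Which of the three fair-rent procedures is plugged in. -/
inductive Objective
  | maximin
  | leximin
  | minSpread

/-- What the allocation computed for each objective has to satisfy. -/
def Objective.IsOptimal {A R : Type*} [Fintype A] (o : Objective) (V : A → R → ℝ)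
    (S : Set ((A ≃ R) × (R → ℝ))) (p : (A ≃ R) × (R → ℝ)) : Prop :=
  match o with
  | .maximin => IsMaximin V S p
  | .leximin => IsLeximin V S p
  | .minSpread => IsMinAbsSpread V S p ∧ IsMinRelSpread V S p

/-- Control states of the budget-aware algorithm. -/
inductive State (A R : Type*)
  | start
  /-- The components in `todo` have not been treated yet; `σ` is the initial assignment and `μ`
  the assignment combined so far. -/
  | components (σ : A ≃ R) (todo : Set (Set R)) (μ : A → R)
  /-- The maximum-rent procedure runs on the component `C`, at the allocation `(ρ, q)` of the rooms
  in `C` to the agents that `σ` places in `C`. -/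
  | maxRent (σ : A ≃ R) (todo : Set (Set R)) (μ : A → R) (C : Set R)
      (ρ : {i : A // σ i ∈ C} ≃ {j : R // j ∈ C}) (q : {j : R // j ∈ C} → ℝ)
  | bounds (μ : A ≃ R) (r : R → ℝ)
  | maximin (μ : A ≃ R) (r : R → ℝ)
  | leximin (μ : A ≃ R) (r : R → ℝ) (F : Set R)
  | minimax (μ : A ≃ R) (r : R → ℝ) (F : Set R)
  | noSolution
  | done (μ : A ≃ R) (r : R → ℝ)

section Algorithm

variable {A R : Type*}

/-- Restriction of a matrix to the rooms in `C` and the agents that `σ` places in `C`. -/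
def restrict (W : A → R → ℝ) (σ : A ≃ R) (C : Set R) :
    {i : A // σ i ∈ C} → {j : R // j ∈ C} → ℝ := fun i j => W i j

open Classical in
/-- Overwrite `μ` by `ρ` on the agents that `σ` places in `C`. -/
def overwrite (σ : A ≃ R) (μ : A → R) (C : Set R)
    (ρ : {i : A // σ i ∈ C} ≃ {j : R // j ∈ C}) : A → R :=
  fun i => if h : σ i ∈ C then (ρ ⟨i, h⟩ : R) else μ i

/-- The absent lower bounds of the rents. -/
def noLower : R → EReal := fun _ => ⊥

/-- The upper bounds of the rents given by the budgets of the occupants. -/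
def budgetUpper (b : A → R → ℝ) (μ : A ≃ R) : R → EReal := fun j => (b (μ.symm j) j : EReal)

open Classical in
/-- The steps of the budget-aware algorithm with the bounds procedure followed by the fair-rent
procedure for the objective `o`. Choices that the algorithm leaves open are nondeterministic. -/
inductive Step [Fintype R] (V b : A → R → ℝ) (Rt : ℝ) (o : Objective) :
    State A R → State A R → Prop
  /-- Compute some envy-free allocation and the components of its envy graph. -/
  | init (R' : ℝ) (σ : A ≃ R) (r : R → ℝ) (h : (σ, r) ∈ EF V R') :
      Step V b Rt o .start (.components σ (components V σ r) σ)
  /-- Start the maximum-rent procedure on a component: take some envy-free allocation of the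
  component and shift its rents such that the budgets hold and somebody is tight. -/
  | enter (σ : A ≃ R) (todo : Set (Set R)) (μ : A → R) (C : Set R) (hC : C ∈ todo)
      (R' Δ : ℝ) (ρ : {i : A // σ i ∈ C} ≃ {j : R // j ∈ C}) (q : {j : R // j ∈ C} → ℝ)
      (h : (ρ, q) ∈ EF (restrict V σ C) R')
      (hΔ : (ρ, fun j => q j - Δ) ∈ EFb (restrict V σ C) (restrict b σ C)
        (R' - Fintype.card {j : R // j ∈ C} * Δ))
      (ht : ∃ i, Tight (restrict b σ C) ρ (fun j => q j - Δ) i) :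
      Step V b Rt o (.components σ todo μ) (.maxRent σ (todo \ {C}) μ C ρ (fun j => q j - Δ))
  | maxRentLoop (σ : A ≃ R) (todo : Set (Set R)) (μ : A → R) (C : Set R)
      (ρ ρ' : {i : A // σ i ∈ C} ≃ {j : R // j ∈ C}) (q q' : {j : R // j ∈ C} → ℝ)
      (h : MaxRentStep (restrict V σ C) (restrict b σ C) (ρ, q) (ρ', q')) :
      Step V b Rt o (.maxRent σ todo μ C ρ q) (.maxRent σ todo μ C ρ' q')
  | maxRentExit (σ : A ≃ R) (todo : Set (Set R)) (μ : A → R) (C : Set R)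
      (ρ : {i : A // σ i ∈ C} ≃ {j : R // j ∈ C}) (q : {j : R // j ∈ C} → ℝ)
      (h : ¬ MaxRentGuard (restrict V σ C) (restrict b σ C) ρ q) :
      Step V b Rt o (.maxRent σ todo μ C ρ q) (.components σ todo (overwrite σ μ C ρ))
  /-- All components are treated: compute envy-free rents of total `Rt` for the combined
  assignment. -/
  | combine (σ : A ≃ R) (todo : Set (Set R)) (f : A → R) (μ : A ≃ R) (r : R → ℝ)
      (hC : todo = ∅) (hf : ∀ i, μ i = f i) (h : (μ, r) ∈ EF V Rt) :
      Step V b Rt o (.components σ todo f) (.bounds μ r)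
  | boundsLoop (μ : A ≃ R) (r r' : R → ℝ)
      (h : BoundsStep V noLower (budgetUpper b μ) μ r r') :
      Step V b Rt o (.bounds μ r) (.bounds μ r')
  | boundsFail (μ : A ≃ R) (r : R → ℝ) (h : BoundsGuard noLower (budgetUpper b μ) r)
      (hf : BoundsFail V noLower (budgetUpper b μ) μ r) :
      Step V b Rt o (.bounds μ r) .noSolution
  /-- Rents within the bounds are found; they are the input of the fair-rent procedure. -/
  | boundsExit (μ : A ≃ R) (r : R → ℝ) (h : ¬ BoundsGuard noLower (budgetUpper b μ) r)
      (ho : o = .maximin ∨ o = .minSpread) :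
      Step V b Rt o (.bounds μ r) (.maximin μ r)
  | boundsExitLeximin (μ : A ≃ R) (r : R → ℝ) (h : ¬ BoundsGuard noLower (budgetUpper b μ) r)
      (ho : o = .leximin) :
      Step V b Rt o (.bounds μ r) (.leximin μ r ∅)
  | maximinLoop (μ : A ≃ R) (r r' : R → ℝ)
      (h : RaiseMinStep V noLower (budgetUpper b μ) μ ∅ r r') :
      Step V b Rt o (.maximin μ r) (.maximin μ r')
  | maximinExit (μ : A ≃ R) (r : R → ℝ)
      (h : ¬ RaiseMinGuard V (budgetUpper b μ) μ ∅ r ∨ (blockedPoorest V noLower μ ∅ r).Nonempty)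
      (ho : o = .maximin) :
      Step V b Rt o (.maximin μ r) (.done μ r)
  /-- For the minimum spread the rents of the poorest rooms are frozen after the maximin phase, and
  the maximum utility of the others is lowered. -/
  | maximinExitSpread (μ : A ≃ R) (r : R → ℝ)
      (h : ¬ RaiseMinGuard V (budgetUpper b μ) μ ∅ r ∨ (blockedPoorest V noLower μ ∅ r).Nonempty)
      (ho : o = .minSpread) :
      Step V b Rt o (.maximin μ r) (.minimax μ r (poorest V μ ∅ r))
  | leximinLoop (μ : A ≃ R) (r r' : R → ℝ) (F : Set R)
      (h : RaiseMinStep V noLower (budgetUpper b μ) μ F r r') :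
      Step V b Rt o (.leximin μ r F) (.leximin μ r' F)
  | leximinFreeze (μ : A ≃ R) (r : R → ℝ) (F : Set R)
      (h : RaiseMinGuard V (budgetUpper b μ) μ F r)
      (hb : (blockedPoorest V noLower μ F r).Nonempty) :
      Step V b Rt o (.leximin μ r F) (.leximin μ r (F ∪ blockedPoorest V noLower μ F r))
  | leximinExit (μ : A ≃ R) (r : R → ℝ) (F : Set R)
      (h : ¬ RaiseMinGuard V (budgetUpper b μ) μ F r) :
      Step V b Rt o (.leximin μ r F) (.done μ r)
  | minimaxLoop (μ : A ≃ R) (r r' : R → ℝ) (F : Set R)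
      (h : LowerMaxStep V noLower (budgetUpper b μ) μ F r r') :
      Step V b Rt o (.minimax μ r F) (.minimax μ r' F)
  | minimaxExit (μ : A ≃ R) (r : R → ℝ) (F : Set R)
      (h : ¬ LowerMaxGuard V noLower μ F r ∨ (blockedRichest V (budgetUpper b μ) μ F r).Nonempty) :
      Step V b Rt o (.minimax μ r F) (.done μ r)

end Algorithm

end RentDivision

end

/-! Two facts about envy-freeness carry the proof. Envy-free assignments maximize total value, so
each of them can be combined with any envy-free rents, and the utilities do not depend on which is
used (`EnvyFree.util_eq`). And for envy-free rents `s`, the difference `s - r` is nondecreasing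
along the envy edges at `r` (`EnvyFree.sub_le_sub_of_reach`).

Hence, on a strongly connected component, envy-free rents are unique up to a constant, and every
envy-free assignment permutes the component. When the maximum-rent procedure stops, some tight agent
lies on no budget cycle. A feasible allocation with higher rents on the component would have to move
this agent, and the permutation between the two assignments would contain such a cycle. So feasible
rents are at most the final ones there, and the final assignment meets its budgets at all of them.
The combined assignment is therefore feasible at all feasible rents (`Combined.supports`), and only
the rents remain to be chosen.

If a competitor's rents do not exceed `r` on a set, they do not exceed `r` on the rooms that reach
it (`EnvyFree.le_of_mem_reachTo`). When no room is free to rise, every room reaches one that is at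
or above its bound, frozen or poorest. A better competitor would then have rents nowhere above `r`,
which the equal totals exclude. For leximin, the frozen rooms are those whose rents every competitor
that is not lexicographically worse shares (`Fixed`). For min-spread, the maximin rents are already
optimal: a richest room reaches a poorest room or a room at its bound, so its occupant can lose
utility only if some poorest agent loses at least as much. The second phase ends without a move.

During a move the velocities are monotone along envy edges, which preserves envy-freeness. Each
event that keeps the set of overpriced rooms makes the rising set smaller or the falling set larger,
so a weighted count decreases at every step (`Step.invariant`). -/

noncomputable section

namespace RentDivision

/-! ### Envy-free rents and assignments, monotonicity along envy edges -/

section EnvyFreeness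

variable {A R : Type*}

/-- Nobody prefers another room at the rents `r`. -/
def EnvyFree (V : A → R → ℝ) (σ : A ≃ R) (r : R → ℝ) : Prop :=
  ∀ i j, util V r i j ≤ util V r i (σ i)

theorem mem_EF_iff [Fintype R] {V : A → R → ℝ} {Rt : ℝ} {σ : A ≃ R} {r : R → ℝ} :
    (σ, r) ∈ EF V Rt ↔ EnvyFree V σ r ∧ ∑ j, r j = Rt := Iff.rfl

theorem mem_EFb_iff [Fintype R] {V b : A → R → ℝ} {Rt : ℝ} {σ : A ≃ R} {r : R → ℝ} :
    (σ, r) ∈ EFb V b Rt ↔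
      EnvyFree V σ r ∧ ∑ j, r j = Rt ∧ ∀ i, r (σ i) ≤ b i (σ i) := by
  simp only [EFb, mem_ofPred_eq, mem_EF_iff, and_assoc]

theorem EnvyFree.add_const {V : A → R → ℝ} {σ : A ≃ R} {r : R → ℝ} (h : EnvyFree V σ r)
    (t : ℝ) : EnvyFree V σ (fun j => r j + t) := by
  intro i j
  have := h i j
  simp only [util] at *
  linarith

/-- All envy-free rents support all envy-free assignments, with the same utilities. -/
theorem EnvyFree.util_eq [Fintype A] [Fintype R] {V : A → R → ℝ} {σ μ : A ≃ R} {r s : R → ℝ}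
    (hσ : EnvyFree V σ r) (hμ : EnvyFree V μ s) (i : A) :
    util V r i (μ i) = util V r i (σ i) := by
  -- Both assignments use every room once, so the rents cancel from the totals and both have the
  -- same total value. Termwise inequalities with equal sums are equalities.
  have h1 : ∑ i, util V s i (σ i) ≤ ∑ i, util V s i (μ i) :=
    Finset.sum_le_sum fun i _ => hμ i _
  have h2 : ∑ i, util V r i (μ i) ≤ ∑ i, util V r i (σ i) :=
    Finset.sum_le_sum fun i _ => hσ i _
  simp only [util, Finset.sum_sub_distrib, Equiv.sum_comp σ, Equiv.sum_comp μ] at h1 h2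
  have h3 : ∑ i, util V r i (μ i) = ∑ i, util V r i (σ i) := by
    simp only [util, Finset.sum_sub_distrib, Equiv.sum_comp σ, Equiv.sum_comp μ]
    linarith
  exact (Finset.sum_eq_sum_iff_of_le fun i _ => hσ i _).1 h3 i (Finset.mem_univ i)

theorem EnvyFree.transfer [Fintype A] [Fintype R] {V : A → R → ℝ} {σ μ : A ≃ R} {r s : R → ℝ}
    (hσ : EnvyFree V σ r) (hμ : EnvyFree V μ s) : EnvyFree V μ r := fun i j =>
  (hσ i j).trans (hσ.util_eq hμ i).ge

theorem EnvyFree.le_util {V : A → R → ℝ} {σ : A ≃ R} {r : R → ℝ} (h : EnvyFree V σ r)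
    (x y : R) : util V r (σ.symm x) y ≤ util V r (σ.symm x) x := by
  simpa using h (σ.symm x) y

/-- At `r` the occupant of `x` likes `y` at least as much as `x`, at `s` at most as much; in the
difference of the two inequalities the valuations cancel. -/
theorem EnvyFree.sub_le_sub {V : A → R → ℝ} {σ : A ≃ R} {r s : R → ℝ} (hs : EnvyFree V σ s)
    {x y : R} (h : EnvyEdge V σ r x y) : s x - r x ≤ s y - r y := by
  have := hs.le_util x y
  simp only [util, EnvyEdge] at *
  linarith

theorem EnvyFree.sub_le_sub_of_reach {V : A → R → ℝ} {σ : A ≃ R} {r s : R → ℝ}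
    (hs : EnvyFree V σ s) {x y : R} (h : Relation.ReflTransGen (EnvyEdge V σ r) x y) :
    s x - r x ≤ s y - r y := by
  induction h with
  | refl => exact le_rfl
  | tail _ h ih => exact ih.trans (hs.sub_le_sub h)

/-- Rents bounded by the rents `r` on `X` are so on all rooms that reach `X`. -/
theorem EnvyFree.le_of_mem_reachTo {V : A → R → ℝ} {σ : A ≃ R} {r s : R → ℝ}
    (hs : EnvyFree V σ s) {X : Set R} (hX : ∀ y ∈ X, s y ≤ r y) {x : R}
    (hx : x ∈ reachTo V σ r X) : s x ≤ r x := by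
  obtain ⟨y, hy, h⟩ := hx
  linarith [hs.sub_le_sub_of_reach h, hX y hy]

theorem subset_reachTo (V : A → R → ℝ) (σ : A ≃ R) (r : R → ℝ) (X : Set R) :
    X ⊆ reachTo V σ r X := fun x hx => ⟨x, hx, .refl⟩

theorem mem_reachTo_of_edge {V : A → R → ℝ} {σ : A ≃ R} {r : R → ℝ} {X : Set R} {x y : R}
    (h : EnvyEdge V σ r x y) (hy : y ∈ reachTo V σ r X) : x ∈ reachTo V σ r X := by
  obtain ⟨z, hz, hyz⟩ := hy
  exact ⟨z, hz, .head h hyz⟩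

theorem subset_reachFrom (V : A → R → ℝ) (σ : A ≃ R) (r : R → ℝ) (X : Set R) :
    X ⊆ reachFrom V σ r X := fun x hx => ⟨x, hx, .refl⟩

theorem reachFrom_empty (V : A → R → ℝ) (σ : A ≃ R) (r : R → ℝ) :
    reachFrom V σ r ∅ = ∅ := by
  ext; simp [reachFrom]

/-- Mutual reachability in the envy graph. -/
def Conn (V : A → R → ℝ) (σ : A ≃ R) (r : R → ℝ) (x y : R) : Prop :=
  Relation.ReflTransGen (EnvyEdge V σ r) x y ∧ Relation.ReflTransGen (EnvyEdge V σ r) y x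

theorem Conn.symm {V : A → R → ℝ} {σ : A ≃ R} {r : R → ℝ} {x y : R} (h : Conn V σ r x y) :
    Conn V σ r y x := ⟨h.2, h.1⟩

theorem Conn.trans {V : A → R → ℝ} {σ : A ≃ R} {r : R → ℝ} {x y z : R} (h : Conn V σ r x y)
    (h' : Conn V σ r y z) : Conn V σ r x z := ⟨h.1.trans h'.1, h'.2.trans h.2⟩

/-- In a finite graph with edges `x → c x`, each room reaches `x` from `c x`. -/
theorem reflTransGen_of_perm [Finite R] {E : R → R → Prop} (c : Equiv.Perm R)
    (h : ∀ x, E x (c x)) (x : R) : Relation.ReflTransGen E (c x) x := by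
  have key : ∀ (k : ℕ) (y : R), Relation.ReflTransGen E y ((c ^ k) y) := by
    intro k
    induction k with
    | zero => intro y; exact .refl
    | succ k ih =>
      intro y
      have := (ih y).tail (h _)
      rwa [pow_succ']
  -- The inverse of `c` is a power of `c`, so going on around the cycle leads back.
  have h1 := key (orderOf c - 1) (c x)
  have h2 : (c ^ (orderOf c - 1)) (c x) = x := by
    rw [← Equiv.Perm.mul_apply, ← pow_succ, Nat.sub_add_cancel (orderOf_pos c), pow_orderOf_eq_one]
    rfl
  rwa [h2] at h1

/-- An envy-free assignment gives each agent a room of the component of its room in any other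
envy-free allocation. -/
theorem EnvyFree.conn [Fintype A] [Fintype R] {V : A → R → ℝ} {σ μ : A ≃ R} {r s : R → ℝ}
    (hσ : EnvyFree V σ r) (hμ : EnvyFree V μ s) (i : A) : Conn V σ r (σ i) (μ i) := by
  -- Agents are indifferent between their rooms in the two assignments, so the permutation from one
  -- to the other follows envy edges.
  have h : ∀ x, EnvyEdge V σ r x ((σ.symm.trans μ) x) := by
    intro x
    have := hσ.util_eq hμ (σ.symm x)
    simp only [EnvyEdge, Equiv.trans_apply, this, Equiv.apply_symm_apply, le_refl]
  refine ⟨.single ?_, ?_⟩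
  · simpa using h (σ i)
  · simpa using reflTransGen_of_perm _ h (σ i)

theorem minUtil_le [Finite A] (V : A → R → ℝ) (p : (A ≃ R) × (R → ℝ)) (i : A) :
    minUtil V p ≤ utilOf V p i := ciInf_le (Set.finite_range _).bddBelow i

theorem le_maxUtil [Finite A] (V : A → R → ℝ) (p : (A ≃ R) × (R → ℝ)) (i : A) :
    utilOf V p i ≤ maxUtil V p := le_ciSup (Set.finite_range _).bddAbove i

theorem utilOf_congr [Fintype A] [Fintype R] {V : A → R → ℝ} {σ μ : A ≃ R} {r s : R → ℝ}
    (hσ : EnvyFree V σ r) (hμ : EnvyFree V μ s) : utilOf V (σ, r) = utilOf V (μ, r) :=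
  funext fun i => (hσ.util_eq hμ i).symm

end EnvyFreeness

/-! ### Existence of envy-free allocations by linear programming duality and Hall's theorem -/

section Existence

variable {A R : Type*} [Fintype A] [Fintype R]

/-- Some allocation is envy-free. -/
theorem exists_envyFree [Nonempty R] (hcard : Fintype.card A = Fintype.card R)
    (V : A → R → ℝ) : ∃ (σ : A ≃ R) (r : R → ℝ), EnvyFree V σ r := by
  classical
  obtain ⟨M, hM⟩ : ∃ M : ℝ, ∀ i j k, V i j - V i k ≤ M := by
    obtain ⟨M, hM⟩ := (Set.finite_range fun p : A × R × R => V p.1 p.2.1 - V p.1 p.2.2).bddAbove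
    exact ⟨M, fun i j k => hM ⟨(i, j, k), rfl⟩⟩
  -- A room that is demanded while another one costs 0 costs at most `M`, so its rent can still be
  -- raised inside the box `[0, K]`.
  set K : ℝ := max M 0 + 1 with hK
  have hKM : M < K := by have := le_max_left M 0; linarith
  have hK0 : 0 < K := by have := le_max_right M 0; linarith
  let W : (R → ℝ) → A → ℝ := fun r i => Finset.univ.sup' Finset.univ_nonempty fun j => V i j - r j
  have hW : ∀ r i j, V i j - r j ≤ W r i := fun r i j =>
    Finset.le_sup' (fun j => V i j - r j) (Finset.mem_univ j)
  have hWle : ∀ r i c, (∀ j, V i j - r j ≤ c) → W r i ≤ c := fun r i c h =>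
    Finset.sup'_le _ _ fun j _ => h j
  -- The dual objective of the assignment problem: indirect utilities plus rents. At a minimizer
  -- every agent can be given a room it demands.
  let F : (R → ℝ) → ℝ := fun r => ∑ i, W r i + ∑ j, r j
  have hF : Continuous F := by
    refine Continuous.add (continuous_finsetSum _ fun i _ => ?_)
      (continuous_finsetSum _ fun j _ => continuous_apply j)
    exact Continuous.finset_sup'_apply _ fun j _ => by fun_prop
  have hcpt : IsCompact (Set.univ.pi fun _ : R => Icc (0 : ℝ) K) :=
    isCompact_univ_pi fun _ => isCompact_Icc
  obtain ⟨r0, hr0, hmin0⟩ := hcpt.exists_isMinOn ⟨0, fun _ _ => ⟨le_rfl, hK0.le⟩⟩ hF.continuousOn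
  have hshift : ∀ (r : R → ℝ) (t : ℝ), F (fun j => r j + t) = F r := by
    intro r t
    have : ∀ i, W (fun j => r j + t) i = W r i - t := by
      intro i
      apply le_antisymm
      · exact hWle _ _ _ fun j => by have := hW r i j; linarith
      · have : W r i ≤ W (fun j => r j + t) i + t :=
          hWle _ _ _ fun j => by have := hW (fun j => r j + t) i j; linarith
        linarith
    simp only [F, this, Finset.sum_sub_distrib, Finset.sum_add_distrib, Finset.sum_const,
      Finset.card_univ, hcard]
    ring
  obtain ⟨j0, hj0⟩ := Finite.exists_min r0
  -- As there are as many agents as rooms, `F` is invariant under shifts, and the cheapest rent can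
  -- be normalized to 0.
  let r : R → ℝ := fun j => r0 j - r0 j0
  have hr : ∀ j, 0 ≤ r j ∧ r j ≤ K := by
    intro j
    have h1 := hr0 j (Set.mem_univ j)
    have h2 := hr0 j0 (Set.mem_univ j0)
    simp only [r]
    exact ⟨by linarith [hj0 j], by linarith [h1.2, h2.1]⟩
  have hmin : ∀ s : R → ℝ, (∀ j, 0 ≤ s j ∧ s j ≤ K) → F r ≤ F s := by
    intro s hs
    have h1 : F r = F r0 := by
      have := hshift r0 (-r0 j0)
      simpa only [r, sub_eq_add_neg] using this
    rw [h1]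
    exact hmin0 fun j _ => hs j
  let T : A → Finset R := fun i => Finset.univ.filter fun j => V i j - r j = W r i
  have hlt : ∀ i j, j ∈ T i → r j < K := by
    intro i j hj
    have h1 : V i j - r j = W r i := by simpa [T] using hj
    have h2 := hW r i j0
    have h3 : r j0 = 0 := by simp [r]
    have := hM i j j0
    linarith
  have hHall : ∀ S : Finset A, S.card ≤ (S.biUnion T).card := by
    intro S
    by_contra hlt'
    rw [not_le] at hlt'
    set N := S.biUnion T with hN
    obtain ⟨ε, hε, hε1, hε2⟩ : ∃ ε : ℝ, 0 < ε ∧ (∀ j ∈ N, r j + ε ≤ K) ∧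
        ∀ i j, j ∉ T i → V i j - r j + ε ≤ W r i := by
      have e1 : ∀ j, ∀ᶠ ε in nhdsWithin (0 : ℝ) (Ioi 0), j ∈ N → r j + ε ≤ K := by
        intro j
        by_cases hj : j ∈ N
        · obtain ⟨i, -, hi⟩ := Finset.mem_biUnion.1 hj
          have : 0 < K - r j := by linarith [hlt i j hi]
          filter_upwards [Ioo_mem_nhdsGT this] with ε hε _
          linarith [hε.2]
        · exact Filter.Eventually.of_forall fun _ h => absurd h hj
      have e2 : ∀ i j, ∀ᶠ ε in nhdsWithin (0 : ℝ) (Ioi 0), j ∉ T i → V i j - r j + ε ≤ W r i := by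
        intro i j
        by_cases hj : j ∈ T i
        · exact Filter.Eventually.of_forall fun _ h => absurd hj h
        · have h1 : V i j - r j ≠ W r i := by simpa [T] using hj
          have : 0 < W r i - (V i j - r j) := by
            have := lt_of_le_of_ne (hW r i j) h1
            linarith
          filter_upwards [Ioo_mem_nhdsGT this] with ε hε _
          linarith [hε.2]
      have e3 : ∀ᶠ ε in nhdsWithin (0 : ℝ) (Ioi 0), 0 < ε := eventually_mem_nhdsWithin
      obtain ⟨ε, h⟩ := (e3.and ((Filter.eventually_all.2 e1).and
        (Filter.eventually_all.2 fun i => Filter.eventually_all.2 (e2 i)))).exists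
      exact ⟨ε, h.1, h.2.1, h.2.2⟩
    -- Raising the rents of an overdemanded set `N` by `ε` costs each agent in `S` at least `ε` of
    -- indirect utility but adds only `|N| ε` to the rents, so `F` falls.
    let s : R → ℝ := fun j => r j + if j ∈ N then ε else 0
    have hs : ∀ j, 0 ≤ s j ∧ s j ≤ K := by
      intro j
      simp only [s]
      split_ifs with h
      · exact ⟨by linarith [(hr j).1], hε1 j h⟩
      · simpa using hr j
    have hWs : ∀ i, W s i ≤ W r i - if i ∈ S then ε else 0 := by
      intro i
      refine hWle _ _ _ fun j => ?_
      have h0 : r j ≤ s j := by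
        simp only [s]; split_ifs <;> linarith
      split_ifs with hi
      · by_cases hj : j ∈ T i
        · have : j ∈ N := Finset.mem_biUnion.2 ⟨i, hi, hj⟩
          have h1 := hW r i j
          simp only [s, this, if_true]
          linarith
        · linarith [hε2 i j hj]
      · linarith [hW r i j]
    have h1 : ∑ i, W s i ≤ ∑ i, W r i - S.card * ε := by
      refine (Finset.sum_le_sum fun i _ => hWs i).trans ?_
      simp [Finset.sum_sub_distrib]
    have h2 : ∑ j, s j = ∑ j, r j + N.card * ε := by
      simp [s, Finset.sum_add_distrib]
    have h3 := hmin s hs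
    have h4 : (N.card : ℝ) < S.card := by exact_mod_cast hlt'
    simp only [F] at h3
    nlinarith
  obtain ⟨f, hf, hfT⟩ := (Finset.all_card_le_biUnion_card_iff_exists_injective T).1 hHall
  refine ⟨Equiv.ofBijective f ((Fintype.bijective_iff_injective_and_card f).2 ⟨hf, hcard⟩), r, ?_⟩
  intro i j
  have : V i (f i) - r (f i) = W r i := by simpa [T] using hfT i
  simp only [util, Equiv.ofBijective_apply, this]
  exact hW r i j

end Existence

/-- Envy-free rents can be shifted to any total. -/
theorem EnvyFree.exists_total {A R : Type*} [Fintype R] [Nonempty R] {V : A → R → ℝ} {σ : A ≃ R}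
    {r : R → ℝ}
    (h : EnvyFree V σ r) (Rt : ℝ) : ∃ s, (σ, s) ∈ EF V Rt := by
  refine ⟨_, h.add_const ((Rt - ∑ j, r j) / Fintype.card R), ?_⟩
  have : (Fintype.card R : ℝ) ≠ 0 := by exact_mod_cast Fintype.card_ne_zero
  simp only [Finset.sum_add_distrib, Finset.sum_const, Finset.card_univ, nsmul_eq_mul]
  field_simp
  ring

/-! ### The maximum-rent procedure on one component -/

section MaxRent

variable {A R : Type*}

/-- Assignments on which the maximum-rent procedure stops satisfy the budgets at all rents, shifted
by a constant, at which some envy-free assignment does. -/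
theorem le_budget_of_not_maxRentGuard [Fintype A] [Fintype R] {V b : A → R → ℝ} {ρ τ : A ≃ R}
    {q s : R → ℝ} (hρ : EnvyFree V ρ q) (hb : ∀ i, q (ρ i) ≤ b i (ρ i))
    (hg : ¬ MaxRentGuard V b ρ q) (hτ : EnvyFree V τ s) (hs : ∀ i, s (τ i) ≤ b i (τ i))
    {δ : ℝ} (hδ : ∀ j, s j = q j + δ) (i : A) : s (ρ i) ≤ b i (ρ i) := by
  classical
  rcases le_or_gt δ 0 with h0 | h0
  · linarith [hb i, hδ (ρ i)]
  exfalso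
  apply hg
  rintro ⟨k, hk, hcyc⟩
  have hne : τ k ≠ ρ k := by
    intro h
    have h1 := hs k
    rw [h, hδ] at h1
    unfold Tight at hk
    linarith
  -- The cycle of this permutation through the tight agent's room is a budget cycle: its edges are
  -- indifferences, and each agent can afford its next room at the rents `q + δ`, hence strictly at
  -- `q`.
  set c : Equiv.Perm R := ρ.symm.trans τ with hc
  have hck : c (ρ k) ≠ ρ k := by simpa [hc] using hne
  refine hcyc ⟨c.cycleOf (ρ k), ⟨Equiv.Perm.isCycle_cycleOf c hck, fun x hx => ?_⟩,
    by simpa using hck⟩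
  have hx' : c.cycleOf (ρ k) x = c x := by
    rw [Equiv.Perm.cycleOf_apply] at hx ⊢
    split_ifs with h
    · rfl
    · simp [h] at hx
  rw [hx']
  refine ⟨?_, ?_⟩
  · have := hρ.util_eq hτ (ρ.symm x)
    simp only [hc, Equiv.trans_apply, this, Equiv.apply_symm_apply, le_refl]
  · have := hs (ρ.symm x)
    rw [hδ] at this
    simp only [hc, Equiv.trans_apply]
    linarith

/-- Number of steps left to the maximum-rent procedure, at most. -/
def maxRentPotential (b : A → R → ℝ) (σ : A ≃ R) (r : R → ℝ) : ℕ :=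
  (Nat.card A + 1) * {p : A × R | r p.2 < b p.1 p.2}.ncard + {i | Tight b σ r i}.ncard

theorem maxRentPotential_le [Finite A] [Finite R] (b : A → R → ℝ) (σ : A ≃ R) (r : R → ℝ) :
    maxRentPotential b σ r ≤
      (Nat.card A + 1) * (Nat.card A * Nat.card R) + Nat.card A := by
  unfold maxRentPotential
  gcongr
  · rw [← Nat.card_prod]
    exact Set.ncard_le_card _
  · exact Set.ncard_le_card _

/-- A raise makes some agent tight, so the pair of this agent and its room is no longer strictly
affordable, and no new pair becomes so. A shuffle keeps the rents, hence all these pairs, and frees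
a tight agent without making another one tight. The weight `Nat.card A + 1` makes the combination
lexicographic. -/
theorem MaxRentStep.invariant [Finite A] [Finite R] {V b : A → R → ℝ}
    {ρ ρ' : A ≃ R} {q q' : R → ℝ} (h : MaxRentStep V b (ρ, q) (ρ', q'))
    (hE : EnvyFree V ρ q) (hb : ∀ i, q (ρ i) ≤ b i (ρ i)) :
    EnvyFree V ρ' q' ∧ (∀ i, q' (ρ' i) ≤ b i (ρ' i)) ∧
      maxRentPotential b ρ' q' < maxRentPotential b ρ q := by
  cases h with
  | raise _ _ Δ hg ht hΔ =>
    refine ⟨hE.add_const Δ, fun i => ?_, ?_⟩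
    · linarith [hΔ.2 ⟨i, rfl⟩]
    · obtain ⟨k, hk⟩ := hΔ.1
      simp only at hk
      have hΔ0 : 0 < Δ := by
        have h1 := hb k
        have h2 : q (ρ k) ≠ b k (ρ k) := fun h => ht ⟨k, h⟩
        have := lt_of_le_of_ne h1 h2
        linarith
      have hlt : {p : A × R | q p.2 + Δ < b p.1 p.2}.ncard <
          {p : A × R | q p.2 < b p.1 p.2}.ncard := by
        apply Set.ncard_lt_ncard _ (Set.toFinite _)
        have hsub : {p : A × R | q p.2 + Δ < b p.1 p.2} ⊆ {p : A × R | q p.2 < b p.1 p.2} :=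
          fun p (hp : q p.2 + Δ < b p.1 p.2) => show q p.2 < b p.1 p.2 by linarith
        refine (Set.ssubset_iff_of_subset hsub).2 ⟨(k, ρ k), ?_, ?_⟩
        · change q (ρ k) < b k (ρ k)
          linarith
        · change ¬ (q (ρ k) + Δ < b k (ρ k))
          linarith
      have hle : {i | Tight b ρ (fun j => q j + Δ) i}.ncard ≤ Nat.card A :=
        Set.ncard_le_card _
      unfold maxRentPotential
      calc _ < (Nat.card A + 1) * ({p : A × R | q p.2 + Δ < b p.1 p.2}.ncard + 1) := by
            rw [mul_add]
            exact Nat.add_lt_add_left (by omega) _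
        _ ≤ (Nat.card A + 1) * {p : A × R | q p.2 < b p.1 p.2}.ncard := by gcongr; exact hlt
        _ ≤ _ := Nat.le_add_right _ _
  | shuffle _ _ i c hg ht hc hi =>
    have hmove : ∀ k, c (ρ k) = ρ k ∨
        (util V q k (c (ρ k)) = util V q k (ρ k) ∧ q (c (ρ k)) < b k (c (ρ k))) := by
      intro k
      by_cases h : c (ρ k) = ρ k
      · exact .inl h
      · have := hc.2 _ h
        simp only [BudgetEdge, Equiv.symm_apply_apply] at this
        exact .inr ⟨le_antisymm (hE k _) this.1, this.2⟩
    refine ⟨fun k j => ?_, fun k => ?_, ?_⟩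
    · rw [Equiv.trans_apply]
      rcases hmove k with h | h
      · rw [h]; exact hE k j
      · rw [h.1]; exact hE k j
    · rw [Equiv.trans_apply]
      rcases hmove k with h | h
      · rw [h]; exact hb k
      · exact h.2.le
    · unfold maxRentPotential
      gcongr
      apply Set.ncard_lt_ncard _ (Set.toFinite _)
      refine (Set.ssubset_iff_of_subset ?_).2 ⟨i, ht, ?_⟩
      · intro k hk
        rcases hmove k with h | h
        · simpa [Tight, h] using hk
        · exact absurd hk (by simpa [Tight] using h.2.ne)
      · rcases hmove i with h | h
        · exact absurd h hi
        · simpa [Tight] using h.2.ne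

theorem exists_maxRentStep [Finite A] [Nonempty A] {V b : A → R → ℝ} {ρ : A ≃ R} {q : R → ℝ}
    (hg : MaxRentGuard V b ρ q) : ∃ ρ' q', MaxRentStep V b (ρ, q) (ρ', q') := by
  by_cases ht : ∃ i, Tight b ρ q i
  · obtain ⟨i, hi⟩ := ht
    have : ∃ c, IsBudgetCycle V b ρ q c ∧ c (ρ i) ≠ ρ i := by
      by_contra h
      exact hg ⟨i, hi, h⟩
    obtain ⟨c, hc, hci⟩ := this
    exact ⟨_, _, .shuffle ρ q i c hg hi hc hci⟩
  · obtain ⟨k, hk⟩ := Finite.exists_min fun i => b i (ρ i) - q (ρ i)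
    exact ⟨_, _, .raise ρ q _ hg ht ⟨⟨k, rfl⟩, by rintro _ ⟨i, rfl⟩; exact hk i⟩⟩

end MaxRent

/-! ### Reduction to strongly connected components -/

section Components

variable {A R : Type*}

/-- The restriction of an assignment to the rooms in `C`. -/
def restrictEquiv (σ : A ≃ R) (C : Set R) : {i : A // σ i ∈ C} ≃ {j : R // j ∈ C} :=
  σ.subtypeEquiv fun _ => Iff.rfl

theorem restrictEquiv_apply (σ : A ≃ R) (C : Set R) (i : {i : A // σ i ∈ C}) :
    (restrictEquiv σ C i : R) = σ i := rfl

theorem EnvyFree.component {V : A → R → ℝ} {σ : A ≃ R} {r : R → ℝ} (h : EnvyFree V σ r)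
    (C : Set R) : EnvyFree (restrict V σ C) (restrictEquiv σ C) (fun j => r j) :=
  fun i j => h i j

theorem conn_of_mem_component {V : A → R → ℝ} {σ : A ≃ R} {r : R → ℝ} {C : Set R}
    (hC : C ∈ components V σ r) {x y : R} (hx : x ∈ C) (hy : y ∈ C) : Conn V σ r x y := by
  obtain ⟨z, rfl⟩ := hC
  exact Conn.trans (Conn.symm hx) hy

theorem mem_component_of_conn {V : A → R → ℝ} {σ : A ≃ R} {r : R → ℝ} {C : Set R}
    (hC : C ∈ components V σ r) {x y : R} (hx : x ∈ C) (h : Conn V σ r x y) : y ∈ C := by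
  obtain ⟨z, rfl⟩ := hC
  exact Conn.trans hx h

theorem mem_component_iff_of_conn {V : A → R → ℝ} {σ : A ≃ R} {r : R → ℝ} {C : Set R}
    (hC : C ∈ components V σ r) {x y : R} (h : Conn V σ r x y) : x ∈ C ↔ y ∈ C :=
  ⟨fun hx => mem_component_of_conn hC hx h, fun hy => mem_component_of_conn hC hy h.symm⟩

theorem nonempty_of_mem_components {V : A → R → ℝ} {σ : A ≃ R} {r : R → ℝ} {C : Set R}
    (hC : C ∈ components V σ r) : C.Nonempty := by
  obtain ⟨z, rfl⟩ := hC
  exact ⟨z, .refl, .refl⟩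

/-- Envy-free rents of a component differ from the original ones by a constant. -/
theorem EnvyFree.sub_le_sub_of_component {V : A → R → ℝ} {σ : A ≃ R} {r : R → ℝ} {C : Set R}
    (hC : C ∈ components V σ r) {q : {j : R // j ∈ C} → ℝ}
    (hq : EnvyFree (restrict V σ C) (restrictEquiv σ C) q) (x y : {j : R // j ∈ C}) :
    q x - r x ≤ q y - r y := by
  have key : ∀ z, Relation.ReflTransGen (EnvyEdge V σ r) z y → ∀ hz : z ∈ C,
      q ⟨z, hz⟩ - r z ≤ q y - r y := by
    intro z hz
    induction hz using Relation.ReflTransGen.head_induction_on with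
    | refl => intro _; exact le_rfl
    | @head z w h hwy ih =>
      intro hz
      -- A path between two rooms of a component stays in it, so envy-freeness within the
      -- sub-instance suffices.
      have hw : w ∈ C := mem_component_of_conn hC hz
        ⟨.single h, hwy.trans (conn_of_mem_component hC y.2 hz).1⟩
      refine le_trans ?_ (ih hw)
      have := hq ⟨σ.symm z, by simpa using hz⟩ ⟨w, hw⟩
      have e : restrictEquiv σ C ⟨σ.symm z, by simpa using hz⟩ = ⟨z, hz⟩ := by
        apply Subtype.ext
        simp [restrictEquiv_apply]
      rw [e] at this
      simp only [util, EnvyEdge, RentDivision.restrict] at *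
      linarith
  exact key x (conn_of_mem_component hC x.2 y.2).1 x.2

/-- Transferred to the restriction of `σ`, the rents `q` differ from `r` by a function that is
monotone along paths in both directions, hence constant. -/
theorem EnvyFree.exists_eq_add [Fintype A] [Fintype R] {V : A → R → ℝ} {σ : A ≃ R} {r : R → ℝ}
    (hσ : EnvyFree V σ r) {C : Set R} (hC : C ∈ components V σ r)
    {ρ : {i : A // σ i ∈ C} ≃ {j : R // j ∈ C}} {q : {j : R // j ∈ C} → ℝ}
    (hq : EnvyFree (restrict V σ C) ρ q) :
    ∃ δ : ℝ, ∀ j : {j : R // j ∈ C}, r j = q j + δ := by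
  classical
  have hq' := hq.transfer (hσ.component C)
  obtain ⟨z, hz⟩ := nonempty_of_mem_components hC
  refine ⟨r z - q ⟨z, hz⟩, fun j => ?_⟩
  have h1 := EnvyFree.sub_le_sub_of_component hC hq' j ⟨z, hz⟩
  have h2 := EnvyFree.sub_le_sub_of_component hC hq' ⟨z, hz⟩ j
  simp only at h1 h2
  linarith

/-- The result of the maximum-rent procedure on a component satisfies the budgets at the rents of
all feasible allocations. -/
theorem le_budget_of_component [Fintype A] [Fintype R] {V b : A → R → ℝ} {σ : A ≃ R} {r : R → ℝ}
    (hσ : EnvyFree V σ r) {C : Set R} (hC : C ∈ components V σ r)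
    {ρ : {i : A // σ i ∈ C} ≃ {j : R // j ∈ C}} {q : {j : R // j ∈ C} → ℝ}
    (hρ : EnvyFree (restrict V σ C) ρ q)
    (hb : ∀ i, q (ρ i) ≤ restrict b σ C i (ρ i))
    (hg : ¬ MaxRentGuard (restrict V σ C) (restrict b σ C) ρ q)
    {τ : A ≃ R} {s : R → ℝ} (hτ : EnvyFree V τ s) (hs : ∀ i, s (τ i) ≤ b i (τ i))
    (i : {i : A // σ i ∈ C}) : s (ρ i) ≤ b i (ρ i) := by
  classical
  -- The competitor permutes the component and so restricts to it; both its rents and `q` are shifts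
  -- of `r` there.
  have hmem : ∀ i, σ i ∈ C ↔ τ i ∈ C := fun i =>
    mem_component_iff_of_conn hC (hσ.conn hτ i)
  let τC : {i : A // σ i ∈ C} ≃ {j : R // j ∈ C} := τ.subtypeEquiv hmem
  have hτC : EnvyFree (restrict V σ C) τC (fun j => s j) := fun i j => hτ i j
  obtain ⟨δ, hδ⟩ := hσ.exists_eq_add hC hρ
  obtain ⟨δ', hδ'⟩ := hσ.exists_eq_add hC hτC
  exact le_budget_of_not_maxRentGuard hρ hb hg hτC (fun i => hs i) (δ := δ - δ')
    (fun j => by linarith [hδ j, hδ' j]) i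

end Components

/-! ### First events of a motion -/

section Events

open Filter Topology

/-- Data varying with time that are eventually constant after the onset of a motion and that cannot
change immediately after a time up to which, inclusively, they were constant. -/
def Tame {κ : Type*} (f : ℝ → κ) : Prop :=
  (∃ c, ∀ᶠ s in 𝓝[>] (0 : ℝ), f s = c) ∧
    ∀ t > 0, (∀ s ∈ Ioo 0 t, f s = f t) → ∀ᶠ s in 𝓝[>] t, f s = f t

theorem tame_const {κ : Type*} (c : κ) : Tame fun _ => c :=
  ⟨⟨c, .of_forall fun _ => rfl⟩, fun _ _ _ => .of_forall fun _ => rfl⟩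

theorem Tame.prodMk {κ κ' : Type*} {f : ℝ → κ} {g : ℝ → κ'} (hf : Tame f) (hg : Tame g) :
    Tame fun s => (f s, g s) := by
  obtain ⟨⟨c, hc⟩, hf⟩ := hf
  obtain ⟨⟨c', hc'⟩, hg⟩ := hg
  refine ⟨⟨(c, c'), ?_⟩, fun t ht h => ?_⟩
  · filter_upwards [hc, hc'] with s h1 h2
    rw [h1, h2]
  · filter_upwards [hf t ht fun s hs => congrArg Prod.fst (h s hs),
      hg t ht fun s hs => congrArg Prod.snd (h s hs)] with s h1 h2
    rw [h1, h2]

theorem Tame.pi {ι : Type*} {κ : ι → Type*} [Finite ι] {f : ℝ → ∀ i, κ i}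
    (hf : ∀ i, Tame fun s => f s i) : Tame f := by
  choose c hc using fun i => (hf i).1
  refine ⟨⟨c, ?_⟩, fun t ht h => ?_⟩
  · filter_upwards [eventually_all.2 hc] with s hs
    exact funext hs
  · filter_upwards [eventually_all.2 fun i => (hf i).2 t ht fun s hs => congrFun (h s hs) i]
      with s hs
    exact funext hs

theorem Tame.comp_injective {κ κ' : Type*} {f : ℝ → κ} (hf : Tame f) {φ : κ → κ'}
    (hφ : Function.Injective φ) : Tame fun s => φ (f s) := by
  obtain ⟨⟨c, hc⟩, hf⟩ := hf
  exact ⟨⟨φ c, hc.mono fun s hs => congrArg φ hs⟩, fun t ht h =>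
    (hf t ht fun s hs => hφ (h s hs)).mono fun s hs => congrArg φ hs⟩

theorem Tame.set {ι : Type*} [Finite ι] {f : ℝ → Set ι} (hf : ∀ i, Tame fun s => i ∈ f s) :
    Tame f := by
  have h : Tame fun s => (fun i => i ∈ f s : ι → Prop) := Tame.pi hf
  refine h.comp_injective (φ := fun p : ι → Prop => {i | p i}) fun p q hpq => ?_
  funext i
  exact congrArg (fun S : Set ι => i ∈ S) hpq

/-- Tame data that do not remain constant forever have a first positive time of change. -/
theorem exists_nextEvent {R κ : Type*} {obs : (R → ℝ) → κ} {r d : R → ℝ}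
    (h : Tame fun s => obs (r + s • d)) (hne : ¬ ∃ c, ∀ s > (0 : ℝ), obs (r + s • d) = c) :
    ∃ t, NextEvent obs r d t := by
  obtain ⟨⟨c, hc⟩, hstep⟩ := h
  set T : Set ℝ := {s | 0 < s ∧ obs (r + s • d) ≠ c} with hT
  have hTne : T.Nonempty := by
    by_contra h
    refine hne ⟨c, fun s hs => ?_⟩
    by_contra h'
    exact h ⟨s, hs, h'⟩
  have hbdd : BddBelow T := ⟨0, fun s hs => hs.1.le⟩
  obtain ⟨ε, hε, hεc⟩ := (mem_nhdsGT_iff_exists_Ioo_subset (a := (0 : ℝ))).1 hc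
  have hε0 : (0 : ℝ) < ε := hε
  have hpos : 0 < sInf T := by
    refine lt_of_lt_of_le hε0 (le_csInf hTne fun s hs => ?_)
    by_contra hlt
    exact hs.2 (hεc ⟨hs.1, not_le.1 hlt⟩)
  have hlt : ∀ s ∈ Ioo 0 (sInf T), obs (r + s • d) = c := by
    intro s hs
    by_contra h
    exact absurd (csInf_le hbdd ⟨hs.1, h⟩) (not_le.2 hs.2)
  -- The infimum of the times of change is attained: otherwise the data would be constant up to and
  -- including it, hence also shortly afterwards.
  have hneq : obs (r + sInf T • d) ≠ c := by
    intro heq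
    have h1 := hstep _ hpos fun s hs => by simp only [hlt s hs, heq]
    obtain ⟨t', ht', ht'c⟩ := (mem_nhdsGT_iff_exists_Ioo_subset).1 h1
    have h2 : sInf T < t' := ht'
    obtain ⟨s, hs, hst⟩ := exists_lt_of_csInf_lt hTne h2
    have h3 : sInf T ≤ s := csInf_le hbdd hs
    rcases h3.eq_or_lt with h3 | h3
    · exact hs.2 (h3 ▸ heq)
    · have h4 : obs (r + s • d) = obs (r + sInf T • d) := ht'c ⟨h3, hst⟩
      exact hs.2 (h4.trans heq)
  exact ⟨sInf T, hpos, fun s hs s' hs' => (hlt s hs).trans (hlt s' hs').symm,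
    fun s hs => by rw [hlt s hs]; exact hneq.symm⟩

theorem eventually_lt_affine {a b t : ℝ} (h : 0 < a + t * b) : ∀ᶠ s in 𝓝[>] t, 0 < a + s * b := by
  have hc : ContinuousAt (fun s : ℝ => a + s * b) t := by fun_prop
  exact (hc.eventually (lt_mem_nhds h)).filter_mono nhdsWithin_le_nhds

theorem eventually_affine_lt {a b t : ℝ} (h : a + t * b < 0) : ∀ᶠ s in 𝓝[>] t, a + s * b < 0 := by
  have hc : ContinuousAt (fun s : ℝ => a + s * b) t := by fun_prop
  exact (hc.eventually (gt_mem_nhds h)).filter_mono nhdsWithin_le_nhds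

theorem eventually_const_affine_nonpos (a b : ℝ) :
    ∃ c : Prop, ∀ᶠ s in 𝓝[>] (0 : ℝ), (a + s * b ≤ 0) = c := by
  rcases lt_trichotomy a 0 with h | h | h
  · refine ⟨True, ?_⟩
    filter_upwards [eventually_affine_lt (a := a) (b := b) (t := 0) (by simpa using h)] with s hs
    simpa using hs.le
  · refine ⟨b ≤ 0, ?_⟩
    filter_upwards [self_mem_nhdsWithin] with s (hs : 0 < s)
    rw [h, zero_add, mul_nonpos_iff_pos_imp_nonpos]
    exact propext ⟨fun h => h.1 hs, fun h => ⟨fun _ => h, fun h' => by linarith⟩⟩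
  · refine ⟨False, ?_⟩
    filter_upwards [eventually_lt_affine (a := a) (b := b) (t := 0) (by simpa using h)] with s hs
    simpa using hs

/-- Without `0 ≤ a` the condition could hold up to and including some time and fail right after it,
with no first time of failure. Starting from a nonnegative value, it holds at a positive time only
if the slope is nonpositive, and then it goes on holding. -/
theorem tame_affine_nonpos {a : ℝ} (ha : 0 ≤ a) (b : ℝ) : Tame fun s => a + s * b ≤ 0 := by
  refine ⟨eventually_const_affine_nonpos a b, fun t ht h => ?_⟩
  rcases le_or_gt (a + t * b) 0 with h0 | h0
  · have hb : b ≤ 0 := by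
      by_contra hb
      nlinarith [mul_pos ht (not_le.1 hb)]
    filter_upwards [self_mem_nhdsWithin] with s (hs : t < s)
    have : a + s * b ≤ 0 := by nlinarith
    simp [h0, this]
  · filter_upwards [eventually_lt_affine h0] with s hs
    simp [not_le.2 hs, not_le.2 h0]

theorem affine_eq_zero {a b t : ℝ} (ht : 0 < t) (h1 : a + t / 2 * b = 0) (h2 : a + t * b = 0) :
    a = 0 ∧ b = 0 := by
  have hb : t * b = 0 := by linarith
  have hb : b = 0 := (mul_eq_zero.1 hb).resolve_left ht.ne'
  exact ⟨by simpa [hb] using h2, hb⟩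

/-- With zeros observed as well, a change of sign is visible at the zero itself and not only after
it. -/
theorem tame_affine_sign (a b : ℝ) : Tame fun s => (0 < a + s * b, a + s * b = 0) := by
  refine ⟨?_, fun t ht h => ?_⟩
  · obtain ⟨c, hc⟩ := eventually_const_affine_nonpos a b
    obtain ⟨c', hc'⟩ := eventually_const_affine_nonpos (-a) (-b)
    refine ⟨(¬ c, c ∧ c'), ?_⟩
    filter_upwards [hc, hc'] with s h1 h2
    rw [← h1, ← h2]
    refine Prod.ext (propext not_le.symm) (propext ⟨fun h => ⟨h.le, by linarith⟩, fun h => ?_⟩)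
    exact le_antisymm h.1 (by linarith [h.2])
  · rcases lt_trichotomy (a + t * b) 0 with h0 | h0 | h0
    · filter_upwards [eventually_affine_lt h0] with s hs
      simp [hs.ne, h0.ne, hs.not_gt, h0.not_gt]
    · have h1 : a + t / 2 * b = 0 :=
        (iff_of_eq (congrArg Prod.snd (h (t / 2) ⟨by linarith, by linarith⟩))).2 h0
      obtain ⟨rfl, rfl⟩ := affine_eq_zero ht h1 h0
      simp
    · filter_upwards [eventually_lt_affine h0] with s hs
      simp [hs.ne', h0.ne', hs, h0]

/-- A nonnegative affine function remains so as long as it does not both have a zero and a positive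
value. -/
theorem affine_nonneg {a b t : ℝ} (ha : 0 ≤ a) (hb : a = 0 → 0 ≤ b)
    (h : ∀ s ∈ Ioo 0 t, ∀ s' ∈ Ioo 0 t, 0 < a + s * b → a + s' * b ≠ 0) :
    ∀ s ∈ Icc 0 t, 0 ≤ a + s * b := by
  intro s hs
  by_contra hneg
  rw [not_le] at hneg
  have hb0 : b < 0 := by
    by_contra hb0
    nlinarith [mul_nonneg hs.1 (not_lt.1 hb0)]
  have ha0 : 0 < a := lt_of_le_of_ne ha fun h0 => absurd (hb h0.symm) (not_le.2 hb0)
  -- The function vanishes at `a / (-b)` and is positive at half that time, which `h` forbids.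
  have h1 : 0 < a / (-b) := by apply div_pos <;> linarith
  have h2 : a / (-b) < s := by
    rw [div_lt_iff₀ (by linarith)]
    linarith
  have h3 : a / (-b) * b = -a := by
    rw [div_neg, neg_mul, div_mul_cancel₀ _ hb0.ne]
  have hs2 := hs.2
  refine h (a / (-b) / 2) ⟨by linarith, by linarith⟩ (a / (-b)) ⟨h1, by linarith⟩ ?_ ?_
  · have : a / (-b) / 2 * b = -a / 2 := by rw [div_mul_eq_mul_div, h3]
    linarith
  · linarith

end Events

/-! ### Directions of motion that preserve envy-freeness -/

section Motion

variable {A R : Type*}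

theorem add_smul_apply' (r d : R → ℝ) (s : ℝ) (j : R) : (r + s • d) j = r j + s * d j := rfl

theorem envyEdge_add_smul_iff {V : A → R → ℝ} {σ : A ≃ R} {r d : R → ℝ} {s : ℝ} {x y : R} :
    EnvyEdge V σ (r + s • d) x y ↔
      (util V r (σ.symm x) x - util V r (σ.symm x) y) + s * (d y - d x) ≤ 0 := by
  simp only [EnvyEdge, util, add_smul_apply']
  constructor <;> intro h <;> linarith

theorem tame_envyEdge [Finite R] {V : A → R → ℝ} {σ : A ≃ R} {r : R → ℝ} (h : EnvyFree V σ r)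
    (d : R → ℝ) : Tame fun s => EnvyEdge V σ (r + s • d) := by
  refine Tame.pi fun x => Tame.pi fun y => ?_
  simp only [envyEdge_add_smul_iff]
  exact tame_affine_nonpos (by linarith [h.le_util x y]) _

/-- As long as no edge enters the envy graph, envy-freeness is preserved by a motion that does not
violate it at its onset. -/
theorem EnvyFree.add_smul {V : A → R → ℝ} {σ : A ≃ R} {r d : R → ℝ} {t : ℝ} (ht : 0 ≤ t)
    (h : EnvyFree V σ r) (hd : ∀ x y, EnvyEdge V σ r x y → d x ≤ d y)
    (hE : ∀ s ∈ Ioo 0 t, ∀ s' ∈ Ioo 0 t,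
      EnvyEdge V σ (r + s • d) = EnvyEdge V σ (r + s' • d)) : EnvyFree V σ (r + t • d) := by
  intro i y
  -- The slack of agent `i` against room `y`: its zeros are edges, so a slack that is positive and
  -- later zero would be an edge entering.
  have key := affine_nonneg (a := util V r i (σ i) - util V r i y) (b := d y - d (σ i)) (t := t)
    (by linarith [h i y])
    (fun h0 => sub_nonneg.2 (hd _ _ (by simp only [EnvyEdge, Equiv.symm_apply_apply]; linarith)))
    (fun s hs s' hs' h1 h2 => by
      have e := iff_of_eq (congrFun (congrFun (hE s hs s' hs') (σ i)) y)
      simp only [envyEdge_add_smul_iff, Equiv.symm_apply_apply] at e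
      linarith [e.2 h2.le]) t ⟨ht, le_rfl⟩
  simp only [util, add_smul_apply'] at *
  linarith

/-- Directions of motion in which the rooms in `I` rise and those in `D` fall, without creating
envy at the onset. -/
structure Admissible (V : A → R → ℝ) (σ : A ≃ R) (r : R → ℝ) (I D : Set R) : Prop where
  disjoint : Disjoint I D
  nonempty_inc : I.Nonempty
  nonempty_dec : D.Nonempty
  mem_dec : ∀ {x y}, EnvyEdge V σ r x y → y ∈ D → x ∈ D
  mem_inc : ∀ {x y}, EnvyEdge V σ r x y → x ∈ I → y ∈ I

theorem velocity_of_mem_inc {I D : Set R} (h : Disjoint I D) {j : R} (hj : j ∈ I) :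
    velocity I D j = 1 := by
  simp [velocity, hj, Set.disjoint_left.1 h hj]

theorem velocity_of_mem_dec {I D : Set R} (h : Disjoint I D) {j : R} (hj : j ∈ D) :
    velocity I D j = -((I.ncard : ℝ) / D.ncard) := by
  simp [velocity, hj, Set.disjoint_right.1 h hj]

theorem velocity_of_notMem {I D : Set R} {j : R} (hI : j ∉ I) (hD : j ∉ D) :
    velocity I D j = 0 := by
  simp [velocity, hI, hD]

theorem velocity_rate_pos [Finite R] {I D : Set R} (hI : I.Nonempty) (hD : D.Nonempty) :
    (0 : ℝ) < (I.ncard : ℝ) / D.ncard :=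
  div_pos (by exact_mod_cast hI.ncard_pos) (by exact_mod_cast hD.ncard_pos)

variable {V : A → R → ℝ} {σ : A ≃ R} {r : R → ℝ} {I D : Set R}

theorem Admissible.velocity_dec_neg [Finite R] (h : Admissible V σ r I D) {j : R} (hj : j ∈ D) :
    velocity I D j < 0 := by
  rw [velocity_of_mem_dec h.disjoint hj]
  linarith [velocity_rate_pos h.nonempty_inc h.nonempty_dec]

theorem Admissible.velocity_nonpos [Finite R] (h : Admissible V σ r I D) {j : R} (hj : j ∉ I) :
    velocity I D j ≤ 0 := by
  by_cases hD : j ∈ D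
  · exact (h.velocity_dec_neg hD).le
  · exact (velocity_of_notMem hj hD).le

theorem Admissible.velocity_nonneg [Finite R] (h : Admissible V σ r I D) {j : R} (hj : j ∉ D) :
    0 ≤ velocity I D j := by
  by_cases hI : j ∈ I
  · rw [velocity_of_mem_inc h.disjoint hI]; exact zero_le_one
  · exact (velocity_of_notMem hI hj).ge

theorem Admissible.velocity_dec_le [Finite R] (h : Admissible V σ r I D) {j k : R} (hj : j ∈ D) :
    velocity I D j ≤ velocity I D k := by
  by_cases hk : k ∈ D
  · rw [velocity_of_mem_dec h.disjoint hj, velocity_of_mem_dec h.disjoint hk]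
  · exact (h.velocity_dec_neg hj).le.trans (h.velocity_nonneg hk)

/-- Falling rooms have the least velocity and rising rooms the greatest. The claim is that no edge
leads from a higher to a lower level, which the two closure properties exclude. -/
theorem Admissible.velocity_le_of_edge [Finite R] (h : Admissible V σ r I D) {x y : R}
    (he : EnvyEdge V σ r x y) : velocity I D x ≤ velocity I D y := by
  by_cases hxI : x ∈ I
  · rw [velocity_of_mem_inc h.disjoint hxI, velocity_of_mem_inc h.disjoint (h.mem_inc he hxI)]
  · by_cases hy : y ∈ D
    · exact h.velocity_dec_le (h.mem_dec he hy)
    · exact (h.velocity_nonpos hxI).trans (h.velocity_nonneg hy)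

theorem Admissible.sum_velocity [Fintype R] (h : Admissible V σ r I D) :
    ∑ j, velocity I D j = 0 := by
  classical
  have hD : (D.ncard : ℝ) ≠ 0 := by exact_mod_cast h.nonempty_dec.ncard_pos.ne'
  have e : ∀ (S : Set R) (c : ℝ), ∑ j, S.indicator (fun _ => c) j = S.ncard * c := by
    intro S c
    simp [Set.indicator_apply, ← Finset.sum_filter, Set.ncard_eq_toFinset_card']
  simp only [velocity, Finset.sum_sub_distrib, e]
  field_simp
  ring

theorem Admissible.sum_add_smul [Fintype R] (h : Admissible V σ r I D) (t : ℝ) :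
    ∑ j, (r + t • velocity I D) j = ∑ j, r j := by
  simp only [add_smul_apply', Finset.sum_add_distrib, ← Finset.mul_sum, h.sum_velocity]
  ring

end Motion

/-! ### Why the number of moves is bounded -/

section Progress

variable {A R : Type*} {V : A → R → ℝ} {σ : A ≃ R} {r : R → ℝ} {X Y X' Y' : Set R}

/-- The rooms that reach neither `X` nor `Y`. -/
def free (V : A → R → ℝ) (σ : A ≃ R) (r : R → ℝ) (X Y : Set R) : Set R :=
  (reachTo V σ r X ∪ reachTo V σ r Y)ᶜ

theorem mem_free_iff {x : R} :
    x ∈ free V σ r X Y ↔ x ∉ reachTo V σ r X ∧ x ∉ reachTo V σ r Y := by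
  simp [free]

theorem admissible_free (hI : (free V σ r X Y).Nonempty) (hX : X.Nonempty) :
    Admissible V σ r (free V σ r X Y) (reachTo V σ r X) where
  disjoint := Set.disjoint_left.2 fun _ hx => (mem_free_iff.1 hx).1
  nonempty_inc := hI
  nonempty_dec := hX.mono (subset_reachTo V σ r X)
  mem_dec := mem_reachTo_of_edge
  mem_inc h hx := by
    rw [mem_free_iff] at *
    exact ⟨fun hy => hx.1 (mem_reachTo_of_edge h hy), fun hy => hx.2 (mem_reachTo_of_edge h hy)⟩

theorem envyEdge_add_smul_of_eq {d : R → ℝ} {t : ℝ} {x y : R} (h : EnvyEdge V σ r x y)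
    (hd : d x = d y) : EnvyEdge V σ (r + t • d) x y := by
  rw [envyEdge_add_smul_iff]
  simp only [EnvyEdge] at h
  rw [hd, sub_self, mul_zero]
  linarith

/-- The falling rooms are still able to reach `X` after the move. -/
theorem reachTo_subset_reachTo_add_smul (hI : (free V σ r X Y).Nonempty) (hX : X.Nonempty)
    (hXX' : X ⊆ X') (t : ℝ) :
    reachTo V σ r X ⊆
      reachTo V σ (r + t • velocity (free V σ r X Y) (reachTo V σ r X)) X' := by
  have hadm := admissible_free hI hX
  rintro x ⟨y, hy, hxy⟩
  induction hxy using Relation.ReflTransGen.head_induction_on with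
  | refl => exact ⟨y, hXX' hy, .refl⟩
  | @head x z hxz hzy ih =>
    have hz : z ∈ reachTo V σ r X := ⟨y, hy, hzy⟩
    refine mem_reachTo_of_edge (envyEdge_add_smul_of_eq hxz ?_) ih
    rw [velocity_of_mem_dec hadm.disjoint hz,
      velocity_of_mem_dec hadm.disjoint (hadm.mem_dec hxz hz)]

/-- The rooms at rest stay at rest or fall in the next move. -/
theorem free_add_smul_subset_free (hI : (free V σ r X Y).Nonempty) (hX : X.Nonempty)
    (hXX' : X ⊆ X') (hYY' : Y \ reachTo V σ r X ⊆ Y') (t : ℝ) :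
    free V σ (r + t • velocity (free V σ r X Y) (reachTo V σ r X)) X' Y' ⊆ free V σ r X Y := by
  have hadm := admissible_free hI hX
  intro x hx
  rw [mem_free_iff] at hx
  have hxX : x ∉ reachTo V σ r X := fun h =>
    hx.1 (reachTo_subset_reachTo_add_smul hI hX hXX' t h)
  refine mem_free_iff.2 ⟨hxX, fun hxY => hx.2 ?_⟩
  have hxX' := hxX
  clear hxX hx
  -- A path to `Y` from a room that is not falling avoids the falling rooms. All its rooms are at
  -- rest, so its edges survive, and its end lies in `Y'`.
  obtain ⟨y, hy, hxy⟩ := hxY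
  induction hxy using Relation.ReflTransGen.head_induction_on with
  | refl => exact ⟨y, hYY' ⟨hy, hxX'⟩, .refl⟩
  | @head x z hxz hzy ih =>
    have hz : z ∉ reachTo V σ r X := fun h => hxX' (mem_reachTo_of_edge hxz h)
    refine mem_reachTo_of_edge (envyEdge_add_smul_of_eq hxz ?_) (ih hz)
    have h1 : x ∉ free V σ r X Y := fun h => (mem_free_iff.1 h).2 ⟨y, hy, .head hxz hzy⟩
    have h2 : z ∉ free V σ r X Y := fun h => (mem_free_iff.1 h).2 ⟨y, hy, hzy⟩
    rw [velocity_of_notMem h1 hxX', velocity_of_notMem h2 hz]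

/-- Decreases as the set of rising rooms shrinks and the set of falling rooms grows. -/
def movePotential (V : A → R → ℝ) (σ : A ≃ R) (r : R → ℝ) (X Y : Set R) : ℕ :=
  (free V σ r X Y).ncard + (reachTo V σ r X)ᶜ.ncard

theorem movePotential_le [Fintype R] : movePotential V σ r X Y ≤ 2 * Fintype.card R := by
  rw [two_mul, movePotential, ← Nat.card_eq_fintype_card]
  exact Nat.add_le_add (Set.ncard_le_card _) (Set.ncard_le_card _)

/-- The rising set only shrinks and the falling set only grows, so a strict change of either one is
enough. -/
theorem movePotential_lt [Finite R] (hI : (free V σ r X Y).Nonempty) (hX : X.Nonempty)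
    (hXX' : X ⊆ X') (hYY' : Y \ reachTo V σ r X ⊆ Y') {t : ℝ} {r' : R → ℝ}
    (hr' : r' = r + t • velocity (free V σ r X Y) (reachTo V σ r X))
    (h : (∃ x ∈ free V σ r X Y, x ∉ free V σ r' X' Y') ∨
      ∃ x ∉ reachTo V σ r X, x ∈ reachTo V σ r' X') :
    movePotential V σ r' X' Y' < movePotential V σ r X Y := by
  have h1 := free_add_smul_subset_free hI hX hXX' hYY' t
  have h2 := reachTo_subset_reachTo_add_smul hI hX hXX' t
  rw [← hr'] at h1 h2
  unfold movePotential
  rcases h with ⟨x, hx, hx'⟩ | ⟨x, hx, hx'⟩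
  · exact Nat.add_lt_add_of_lt_of_le
      (Set.ncard_lt_ncard ((Set.ssubset_iff_of_subset h1).2 ⟨x, hx, hx'⟩) (Set.toFinite _))
      (Set.ncard_le_ncard (Set.compl_subset_compl.2 h2) (Set.toFinite _))
  · exact Nat.add_lt_add_of_le_of_lt (Set.ncard_le_ncard h1 (Set.toFinite _))
      (Set.ncard_lt_ncard ((Set.ssubset_iff_of_subset (Set.compl_subset_compl.2 h2)).2
        ⟨x, hx, fun h => h hx'⟩) (Set.toFinite _))

/-- An edge entering the envy graph makes the set of rising rooms smaller or the set of falling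
rooms larger. -/
theorem exists_change_of_edge [Finite R] (hE : EnvyFree V σ r) (hI : (free V σ r X Y).Nonempty)
    (hX : X.Nonempty)
    (hXX' : X ⊆ X') (hYY' : Y \ reachTo V σ r X ⊆ Y') {s t : ℝ} (hs : s ∈ Ioo 0 t) {r' d : R → ℝ}
    (hd : d = velocity (free V σ r X Y) (reachTo V σ r X)) (hr' : r' = r + t • d)
    (hne : EnvyEdge V σ (r + s • d) ≠ EnvyEdge V σ r') :
    (∃ x ∈ free V σ r X Y, x ∉ free V σ r' X' Y') ∨
      ∃ x ∉ reachTo V σ r X, x ∈ reachTo V σ r' X' := by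
  have hadm := admissible_free hI hX
  have h1 := free_add_smul_subset_free hI hX hXX' hYY' t
  have h2 := reachTo_subset_reachTo_add_smul hI hX hXX' t
  rw [← hd, ← hr'] at h1 h2
  obtain ⟨hs0, hst⟩ := hs
  obtain ⟨x, y, hxy⟩ : ∃ x y, ¬ (EnvyEdge V σ (r + s • d) x y ↔ EnvyEdge V σ r' x y) := by
    by_contra! h
    exact hne (funext fun x => funext fun y => propext (h x y))
  have ha := hE.le_util x y
  -- The slack is affine and nonnegative at the onset, so at positive times an edge can only appear,
  -- and only if its head is slower than its tail.
  have hxy' : EnvyEdge V σ r' x y ∧ d y < d x := by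
    rw [hr', envyEdge_add_smul_iff, envyEdge_add_smul_iff] at hxy
    rw [hr', envyEdge_add_smul_iff]
    by_cases hlt : d y < d x
    · refine ⟨?_, hlt⟩
      by_contra h
      refine hxy ⟨fun h' => absurd ?_ h, fun h' => absurd h' h⟩
      nlinarith
    · exfalso
      refine hxy ⟨fun h => ?_, fun h => ?_⟩ <;> nlinarith
  obtain ⟨he, hlt⟩ := hxy'
  -- If the head falls, the tail becomes a falling room. Otherwise the tail was rising and the head
  -- at rest, and the new edge takes the tail out of the rising set.
  by_cases hy : y ∈ reachTo V σ r X
  · refine .inr ⟨x, fun hx => ?_, mem_reachTo_of_edge he (h2 hy)⟩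
    rw [hd] at hlt
    exact absurd (hadm.velocity_dec_le hx) (not_le.2 hlt)
  · have hx : x ∈ free V σ r X Y := by
      by_contra hx
      rw [hd] at hlt
      linarith [hadm.velocity_nonpos hx, hadm.velocity_nonneg hy]
    have hy' : y ∉ free V σ r X Y := by
      intro hy'
      rw [hd, velocity_of_mem_inc hadm.disjoint hx, velocity_of_mem_inc hadm.disjoint hy'] at hlt
      exact lt_irrefl _ hlt
    refine .inl ⟨x, hx, fun hx' => hy' (h1 ?_)⟩
    rw [mem_free_iff] at hx' ⊢
    exact ⟨fun h => hx'.1 (mem_reachTo_of_edge he h), fun h => hx'.2 (mem_reachTo_of_edge he h)⟩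

end Progress

/-! ### Budgets as upper bounds of the rents -/

section BoundSets

variable {A R : Type*} {V b : A → R → ℝ} {σ : A ≃ R} {r : R → ℝ}

theorem tooLow_noLower (r : R → ℝ) : tooLow noLower r = ∅ := by
  ext; simp [tooLow, noLower]

theorem atBound_noLower (r : R → ℝ) : atBound noLower r = ∅ := by
  ext; simp [atBound, noLower]

theorem mem_tooHigh_iff {j : R} :
    j ∈ tooHigh (budgetUpper b σ) r ↔ b (σ.symm j) j < r j := by
  simp [tooHigh, budgetUpper]

theorem mem_atBound_iff {j : R} :
    j ∈ atBound (budgetUpper b σ) r ↔ r j = b (σ.symm j) j := by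
  simp [atBound, budgetUpper]

theorem mem_tooHigh_add_smul_iff {d : R → ℝ} {s : ℝ} {j : R} :
    j ∈ tooHigh (budgetUpper b σ) (r + s • d) ↔ 0 < (r j - b (σ.symm j) j) + s * d j := by
  rw [mem_tooHigh_iff, add_smul_apply']
  constructor <;> intro h <;> linarith

theorem mem_atBound_add_smul_iff {d : R → ℝ} {s : ℝ} {j : R} :
    j ∈ atBound (budgetUpper b σ) (r + s • d) ↔ (r j - b (σ.symm j) j) + s * d j = 0 := by
  rw [mem_atBound_iff, add_smul_apply']
  constructor <;> intro h <;> linarith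

theorem not_boundsGuard_iff :
    ¬ BoundsGuard noLower (budgetUpper b σ) r ↔ ∀ i, r (σ i) ≤ b i (σ i) := by
  rw [BoundsGuard, tooLow_noLower, empty_union, not_nonempty_iff_eq_empty,
    Set.eq_empty_iff_forall_notMem]
  refine ⟨fun h i => ?_, fun h j => ?_⟩
  · simpa [mem_tooHigh_iff] using h (σ i)
  · simpa [mem_tooHigh_iff] using h (σ.symm j)

theorem boundsGuard_iff :
    BoundsGuard noLower (budgetUpper b σ) r ↔ (tooHigh (budgetUpper b σ) r).Nonempty := by
  rw [BoundsGuard, tooLow_noLower, empty_union]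

theorem boundsInc_eq : boundsInc V noLower (budgetUpper b σ) σ r =
    free V σ r (tooHigh (budgetUpper b σ) r) (atBound (budgetUpper b σ) r) := by
  simp [boundsInc, tooLow_noLower, free, union_comm]

theorem boundsDec_eq (h : BoundsGuard noLower (budgetUpper b σ) r) :
    boundsDec V noLower (budgetUpper b σ) σ r =
      reachTo V σ r (tooHigh (budgetUpper b σ) r) := by
  simp [boundsDec, boundsGuard_iff.1 h]

theorem boundsFail_iff (h : BoundsGuard noLower (budgetUpper b σ) r) :
    BoundsFail V noLower (budgetUpper b σ) σ r ↔
      free V σ r (tooHigh (budgetUpper b σ) r) (atBound (budgetUpper b σ) r) = ∅ := by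
  have h1 : reachTo V σ r (tooHigh (budgetUpper b σ) r) ≠ ∅ :=
    ((boundsGuard_iff.1 h).mono (subset_reachTo V σ r _)).ne_empty
  simp [BoundsFail, boundsInc_eq, boundsDec_eq h, tooLow_noLower, atBound_noLower,
    reachFrom_empty, h1]

/-- If a room rises above its bound, it has been at its bound before. -/
theorem le_bound_of_atBound_const {d : R → ℝ} {t : ℝ} (ht : 0 ≤ t) {j : R}
    (hj : r j ≤ b (σ.symm j) j) (hd : r j = b (σ.symm j) j → d j ≤ 0)
    (hB : ∀ s ∈ Ioo 0 t, ∀ s' ∈ Ioo 0 t, (j ∈ atBound (budgetUpper b σ) (r + s • d) ↔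
      j ∈ atBound (budgetUpper b σ) (r + s' • d))) : (r + t • d) j ≤ b (σ.symm j) j := by
  have := affine_nonneg (a := b (σ.symm j) j - r j) (b := - d j) (t := t) (by linarith)
    (fun h => by linarith [hd (by linarith)])
    (fun s hs s' hs' h1 h2 => by
      have := (hB s hs s' hs').2 (mem_atBound_add_smul_iff.2 (by linarith))
      rw [mem_atBound_add_smul_iff] at this
      linarith) t ⟨ht, le_rfl⟩
  rw [add_smul_apply']
  linarith

end BoundSets

/-! ### The bounds procedure -/

section Bounds

variable {A R : Type*} [Fintype R] {V b : A → R → ℝ} {σ : A ≃ R} {r : R → ℝ}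

/-- Number of steps left to the bounds procedure, at most. -/
def boundsPotential (V b : A → R → ℝ) (σ : A ≃ R) (r : R → ℝ) : ℕ :=
  (2 * Fintype.card R + 1) * (tooHigh (budgetUpper b σ) r).ncard +
    movePotential V σ r (tooHigh (budgetUpper b σ) r) (atBound (budgetUpper b σ) r)

theorem boundsPotential_le : boundsPotential V b σ r ≤
    (2 * Fintype.card R + 1) * Fintype.card R + 2 * Fintype.card R := by
  unfold boundsPotential
  gcongr
  · rw [← Nat.card_eq_fintype_card]
    exact Set.ncard_le_card _
  · exact movePotential_le

/-- No room becomes overpriced, because it would first reach its bound, which is an event. If the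
overpriced rooms are still the same after the move, the event is a new edge or a room arriving at
its bound, and `movePotential` decreases. -/
theorem BoundsStep.invariant {r' : R → ℝ} (hE : EnvyFree V σ r)
    (h : BoundsStep V noLower (budgetUpper b σ) σ r r') :
    EnvyFree V σ r' ∧ ∑ j, r' j = ∑ j, r j ∧ boundsPotential V b σ r' < boundsPotential V b σ r := by
  obtain ⟨hg, hf, t, ⟨ht, hconst, hne⟩, hr'⟩ := h
  rw [boundsFail_iff hg, ← ne_eq, ← nonempty_iff_ne_empty] at hf
  rw [boundsDec_eq hg, boundsInc_eq] at hr' hconst hne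
  have hU := boundsGuard_iff.1 hg
  have hadm := admissible_free hf hU
  set I := free V σ r (tooHigh (budgetUpper b σ) r) (atBound (budgetUpper b σ) r) with hI
  set D := reachTo V σ r (tooHigh (budgetUpper b σ) r) with hD
  set d := velocity I D with hd
  simp only [Prod.mk.injEq, tooLow_noLower, atBound_noLower, true_and] at hconst hne
  have hBI : ∀ j ∈ atBound (budgetUpper b σ) r, j ∉ I := fun j hj hjI =>
    (mem_free_iff.1 hjI).2 (subset_reachTo V σ r _ hj)
  have hUD : ∀ j, b (σ.symm j) j < r j → j ∈ D := fun j hj =>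
    subset_reachTo V σ r _ (mem_tooHigh_iff.2 hj)
  have hBconst : ∀ j, ∀ s ∈ Ioo 0 t, ∀ s' ∈ Ioo 0 t,
      (j ∈ atBound (budgetUpper b σ) (r + s • d) ↔ j ∈ atBound (budgetUpper b σ) (r + s' • d)) :=
    fun j s hs s' hs' => by rw [(hconst s hs s' hs').2.2]
  have hstay : ∀ s ∈ Icc 0 t, ∀ j, r j ≤ b (σ.symm j) j → (r + s • d) j ≤ b (σ.symm j) j :=
    fun s hs j hj => le_bound_of_atBound_const hs.1 hj
      (fun h => hadm.velocity_nonpos (hBI j (mem_atBound_iff.2 h)))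
      fun s' hs' s'' hs'' => hBconst j _ ⟨hs'.1, hs'.2.trans_le hs.2⟩ _
        ⟨hs''.1, hs''.2.trans_le hs.2⟩
  refine ⟨?_, ?_, ?_⟩
  · rw [hr']
    exact hE.add_smul ht.le (fun x y => hadm.velocity_le_of_edge)
      fun s hs s' hs' => (hconst s hs s' hs').1
  · rw [hr']
    exact hadm.sum_add_smul t
  have hsub : tooHigh (budgetUpper b σ) r' ⊆ tooHigh (budgetUpper b σ) r := by
    intro j hj
    rw [mem_tooHigh_iff] at hj ⊢
    by_contra h
    have := hstay t ⟨ht.le, le_rfl⟩ j (not_lt.1 h)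
    rw [← hr'] at this
    linarith
  unfold boundsPotential
  by_cases heq : tooHigh (budgetUpper b σ) r' = tooHigh (budgetUpper b σ) r
  swap
  · have hlt := Set.ncard_lt_ncard (hsub.ssubset_of_ne heq) (Set.toFinite _)
    calc _ ≤ (2 * Fintype.card R + 1) * (tooHigh (budgetUpper b σ) r').ncard + 2 * Fintype.card R :=
          Nat.add_le_add_left movePotential_le _
      _ < (2 * Fintype.card R + 1) * ((tooHigh (budgetUpper b σ) r').ncard + 1) := by
          rw [mul_add]; omega
      _ ≤ (2 * Fintype.card R + 1) * (tooHigh (budgetUpper b σ) r).ncard := by gcongr; exact hlt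
      _ ≤ _ := Nat.le_add_right _ _
  rw [heq]
  have hYY' : atBound (budgetUpper b σ) r \ D ⊆ atBound (budgetUpper b σ) r' := by
    rintro j ⟨hj, hjD⟩
    rw [hr', mem_atBound_add_smul_iff, hd, velocity_of_notMem (hBI j hj) hjD]
    rw [mem_atBound_iff] at hj
    linarith
  refine Nat.add_lt_add_left (movePotential_lt hf hU subset_rfl hYY' hr' ?_) _
  have hs : t / 2 ∈ Ioo 0 t := ⟨by linarith, by linarith⟩
  by_cases h1 : EnvyEdge V σ (r + (t / 2) • d) = EnvyEdge V σ r'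
  swap
  · exact exists_change_of_edge hE hf hU subset_rfl hYY' hs hd hr' h1
  have hfall : ∀ j, b (σ.symm j) j < r j → b (σ.symm j) j < r' j := fun j hj =>
    mem_tooHigh_iff.1 (heq ▸ mem_tooHigh_iff.2 hj)
  have h2 : tooHigh (budgetUpper b σ) (r + (t / 2) • d) = tooHigh (budgetUpper b σ) r' := by
    ext j
    rw [mem_tooHigh_iff, mem_tooHigh_iff]
    by_cases hj : b (σ.symm j) j < r j
    · have h3 := hfall j hj
      simp only [h3, iff_true]
      rw [hr', add_smul_apply'] at h3
      rw [add_smul_apply']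
      linarith
    · have h3 := hstay _ ⟨hs.1.le, hs.2.le⟩ j (not_lt.1 hj)
      have h4 := hstay t ⟨ht.le, le_rfl⟩ j (not_lt.1 hj)
      rw [← hr'] at h4
      exact iff_of_false (not_lt.2 h3) (not_lt.2 h4)
  have h3 : atBound (budgetUpper b σ) (r + (t / 2) • d) ≠ atBound (budgetUpper b σ) r' := by
    intro h3
    have := hne (t / 2) hs
    rw [← hr'] at this
    exact this (by rw [h1, h2, h3])
  obtain ⟨j, hj⟩ : ∃ j, ¬ (j ∈ atBound (budgetUpper b σ) (r + (t / 2) • d) ↔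
      j ∈ atBound (budgetUpper b σ) r') := by
    by_contra! h
    exact h3 (Set.ext h)
  -- A room at its bound at two times of the motion is at rest, so it cannot leave the bound at time
  -- `t`; the change must be an arrival.
  have hj' : j ∈ atBound (budgetUpper b σ) r' := by
    by_contra hj'
    simp only [hj', iff_false, not_not] at hj
    have h4 := (hBconst j (t / 2) hs (t / 4) ⟨by linarith, by linarith⟩).1 hj
    rw [mem_atBound_add_smul_iff] at hj h4
    rw [hr', mem_atBound_add_smul_iff] at hj'
    exact hj' (by linarith)
  refine .inl ⟨j, ?_, fun h => (mem_free_iff.1 h).2 (subset_reachTo V σ r' _ hj')⟩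
  -- A room that is not rising and starts at most at its bound can be there at time `t` only if it
  -- rested there all along.
  by_contra hjI
  have hjd := hadm.velocity_nonpos hjI
  rw [← hd] at hjd
  have h5 := mem_atBound_iff.1 hj'
  have h6 : r j ≤ b (σ.symm j) j := by
    by_contra h
    linarith [hfall j (not_le.1 h)]
  have h7 : d j = 0 := by
    rw [hr', add_smul_apply'] at h5
    nlinarith
  rw [hr', mem_atBound_add_smul_iff, mem_atBound_add_smul_iff, h7] at hj
  simp at hj

theorem exists_boundsStep (hE : EnvyFree V σ r) (hg : BoundsGuard noLower (budgetUpper b σ) r)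
    (hf : ¬ BoundsFail V noLower (budgetUpper b σ) σ r) :
    ∃ r', BoundsStep V noLower (budgetUpper b σ) σ r r' := by
  have hf' := hf
  rw [boundsFail_iff hg, ← ne_eq, ← nonempty_iff_ne_empty] at hf'
  have hU := boundsGuard_iff.1 hg
  have hadm := admissible_free hf' hU
  rw [← boundsInc_eq, ← boundsDec_eq hg] at hadm
  suffices ∃ t, NextEvent (fun q => (EnvyEdge V σ q, tooLow noLower q,
      tooHigh (budgetUpper b σ) q, atBound noLower q, atBound (budgetUpper b σ) q)) r
      (velocity (boundsInc V noLower (budgetUpper b σ) σ r)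
        (boundsDec V noLower (budgetUpper b σ) σ r)) t by
    obtain ⟨t, ht⟩ := this
    exact ⟨_, hg, hf, t, ht, rfl⟩
  set d := velocity (boundsInc V noLower (budgetUpper b σ) σ r)
    (boundsDec V noLower (budgetUpper b σ) σ r) with hd
  apply exists_nextEvent
  · have h1 : Tame fun s => (EnvyEdge V σ (r + s • d),
        (fun j => (j ∈ tooHigh (budgetUpper b σ) (r + s • d),
          j ∈ atBound (budgetUpper b σ) (r + s • d)) : R → Prop × Prop)) := by
      refine (tame_envyEdge hE d).prodMk (Tame.pi fun j => ?_)
      simp only [mem_tooHigh_add_smul_iff, mem_atBound_add_smul_iff]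
      exact tame_affine_sign _ _
    have h2 := h1.comp_injective
      (φ := fun p => (p.1, (∅ : Set R), {j | (p.2 j).1}, (∅ : Set R), {j | (p.2 j).2})) ?_
    · simpa only [tooLow_noLower, atBound_noLower, Set.ofPred_mem_eq] using h2
    · rintro ⟨E, f⟩ ⟨E', f'⟩ h
      simp only [Prod.mk.injEq, true_and] at h
      refine Prod.ext h.1 (funext fun j => Prod.ext ?_ ?_)
      · exact congrArg (fun S : Set R => j ∈ S) h.2.1
      · exact congrArg (fun S : Set R => j ∈ S) h.2.2
  · rintro ⟨c, hc⟩
    -- An overpriced room falls at a positive rate, so it reaches its bound and the data do change.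
    obtain ⟨j, hj⟩ := hU
    have hjd : d j < 0 := hadm.velocity_dec_neg (by
      rw [boundsDec_eq hg]; exact subset_reachTo V σ r _ hj)
    rw [mem_tooHigh_iff] at hj
    set a := r j - b (σ.symm j) j with ha
    have ha0 : 0 < a := by rw [ha]; linarith
    have hs : 0 < a / (-d j) := div_pos ha0 (by linarith)
    have h1 := (hc (a / (-d j) / 2) (by linarith)).trans (hc (a / (-d j)) hs).symm
    simp only [Prod.mk.injEq] at h1
    have h2 : j ∈ tooHigh (budgetUpper b σ) (r + (a / (-d j) / 2) • d) ↔
      j ∈ tooHigh (budgetUpper b σ) (r + (a / (-d j)) • d) := by rw [h1.2.2.1]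
    have h3 : a / (-d j) * d j = -a := by
      rw [div_neg, neg_mul, div_mul_cancel₀ _ hjd.ne]
    rw [mem_tooHigh_add_smul_iff, mem_tooHigh_add_smul_iff, div_mul_eq_mul_div, h3, ← ha] at h2
    have := h2.1 (by linarith)
    linarith

/-- If no rent can be raised to compensate for the rents that have to fall, there are no rents within
the bounds. -/
theorem not_feasible_of_boundsFail (hg : BoundsGuard noLower (budgetUpper b σ) r)
    (hf : BoundsFail V noLower (budgetUpper b σ) σ r) {s : R → ℝ} (hs : EnvyFree V σ s)
    (hsum : ∑ j, s j = ∑ j, r j) (hb : ∀ i, s (σ i) ≤ b i (σ i)) : False := by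
  rw [boundsFail_iff hg] at hf
  obtain ⟨k, hk⟩ := boundsGuard_iff.1 hg
  have hb' : ∀ j, s j ≤ b (σ.symm j) j := fun j => by simpa using hb (σ.symm j)
  have hle : ∀ j, s j ≤ r j := by
    intro j
    have hj : j ∉ free V σ r (tooHigh (budgetUpper b σ) r) (atBound (budgetUpper b σ) r) := by
      rw [hf]; exact notMem_empty j
    rw [mem_free_iff, not_and_or, not_not, not_not] at hj
    rcases hj with hj | hj
    · exact hs.le_of_mem_reachTo (fun y hy => (hb' y).trans (mem_tooHigh_iff.1 hy).le) hj
    · exact hs.le_of_mem_reachTo (fun y hy => (hb' y).trans (mem_atBound_iff.1 hy).ge) hj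
  have := Finset.sum_lt_sum (fun j _ => hle j)
    ⟨k, Finset.mem_univ k, (hb' k).trans_lt (mem_tooHigh_iff.1 hk)⟩
  linarith

end Bounds

/-! ### Raising the minimum utility -/

section RaiseMin

open Filter Topology

variable {A R : Type*} {V b : A → R → ℝ} {σ : A ≃ R} {r : R → ℝ} {F : Set R}

theorem poorest_nonempty [Finite R] (hF : F ≠ univ) : (poorest V σ F r).Nonempty := by
  obtain ⟨j, hj, hmin⟩ := Set.exists_min_image Fᶜ (fun j => util V r (σ.symm j) j)
    (Set.toFinite _) (nonempty_compl.2 hF)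
  exact ⟨j, hj, fun k hk => hmin k hk⟩

theorem richest_nonempty [Finite R] (hF : F ≠ univ) : (richest V σ F r).Nonempty := by
  obtain ⟨j, hj, hmax⟩ := Set.exists_max_image Fᶜ (fun j => util V r (σ.symm j) j)
    (Set.toFinite _) (nonempty_compl.2 hF)
  exact ⟨j, hj, fun k hk => hmax k hk⟩

theorem blockedPoorest_noLower :
    blockedPoorest V noLower σ F r = reachFrom V σ r F ∩ poorest V σ F r := by
  rw [blockedPoorest, atBound_noLower, empty_union]

theorem raiseMinGuard_iff {u : R → EReal} : RaiseMinGuard V u σ F r ↔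
    (free V σ r (poorest V σ F r) (atBound u r ∪ F)).Nonempty := by
  rw [RaiseMinGuard, free, nonempty_compl]

theorem not_raiseMinGuard_iff {u : R → EReal} : ¬ RaiseMinGuard V u σ F r ↔
    ∀ x, x ∈ reachTo V σ r (poorest V σ F r) ∨ x ∈ reachTo V σ r (atBound u r ∪ F) := by
  rw [RaiseMinGuard, not_not, Set.eq_univ_iff_forall]
  rfl

theorem RaiseMinGuard.ne_univ {u : R → EReal} (h : RaiseMinGuard V u σ F r) : F ≠ univ := by
  rintro rfl
  apply h
  rw [union_univ, Set.eq_univ_iff_forall]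
  exact fun x => .inr (subset_reachTo V σ r _ (mem_univ x))

theorem util_add_smul (d : R → ℝ) (s : ℝ) (i : A) (j : R) :
    util V (r + s • d) i j = util V r i j - s * d j := by
  simp only [util, add_smul_apply']
  ring

theorem util_add_smul_le_iff (d : R → ℝ) (s : ℝ) (i k : A) (j l : R) :
    util V (r + s • d) i j ≤ util V (r + s • d) k l ↔
      (util V r i j - util V r k l) + s * (d l - d j) ≤ 0 := by
  rw [util_add_smul, util_add_smul]
  constructor <;> intro h <;> linarith

/-- A poorest room leaves the set only after a tie with another room, which is itself poorest at the
tie. If the set was constant through that instant, both rooms were poorest all along and the tie is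
permanent. A room outside the set is strictly richer than some other one and stays so for a while.
-/
theorem tame_poorest [Finite R] (V : A → R → ℝ) (σ : A ≃ R) (F : Set R) (r d : R → ℝ) :
    Tame fun s => poorest V σ F (r + s • d) := by
  refine ⟨?_, fun t ht h => ?_⟩
  · choose c hc using fun j k => eventually_const_affine_nonpos
      (util V r (σ.symm j) j - util V r (σ.symm k) k) (d k - d j)
    refine ⟨{j | j ∉ F ∧ ∀ k ∉ F, c j k}, ?_⟩
    filter_upwards [eventually_all.2 fun j => eventually_all.2 fun k => hc j k] with s hs
    ext j
    simp only [poorest, util_add_smul_le_iff, hs]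
  · have key : ∀ j k, ∀ᶠ s in 𝓝[>] t, j ∉ F → k ∉ F →
        (j ∈ poorest V σ F (r + t • d) →
          util V (r + s • d) (σ.symm j) j ≤ util V (r + s • d) (σ.symm k) k) ∧
        (¬ util V (r + t • d) (σ.symm j) j ≤ util V (r + t • d) (σ.symm k) k →
          ¬ util V (r + s • d) (σ.symm j) j ≤ util V (r + s • d) (σ.symm k) k) := by
      intro j k
      simp only [util_add_smul_le_iff]
      rcases lt_trichotomy ((util V r (σ.symm j) j - util V r (σ.symm k) k) + t * (d k - d j)) 0
        with h0 | h0 | h0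
      · filter_upwards [eventually_affine_lt h0] with s hs _ _
        exact ⟨fun _ => hs.le, fun h => absurd h0.le h⟩
      · refine .of_forall fun s hj hk => ⟨fun hjt => ?_, fun h => absurd h0.le h⟩
        have hjt2 := hjt.2
        simp only [util_add_smul_le_iff] at hjt2
        have hkt : k ∈ poorest V σ F (r + t • d) := by
          refine ⟨hk, fun l hl => ?_⟩
          rw [util_add_smul_le_iff]
          linarith [hjt2 l hl]
        have hh : t / 2 ∈ Ioo 0 t := ⟨by linarith, by linarith⟩
        have hh' : poorest V σ F (r + (t / 2) • d) = poorest V σ F (r + t • d) := h _ hh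
        rw [← hh'] at hjt hkt
        have h1 := hjt.2 k hk
        have h2 := hkt.2 j hj
        rw [util_add_smul_le_iff] at h1 h2
        obtain ⟨h3, h4⟩ := affine_eq_zero ht (le_antisymm h1 (by linarith)) h0
        rw [h3, h4]
        simp
      · filter_upwards [eventually_lt_affine h0] with s hs _ _
        refine ⟨fun hjt => ?_, fun _ => not_le.2 hs⟩
        have := hjt.2 k ‹_›
        rw [util_add_smul_le_iff] at this
        linarith
    filter_upwards [eventually_all.2 fun j => eventually_all.2 fun k => key j k] with s hs
    ext j
    constructor
    · intro hj
      refine ⟨hj.1, fun k hk => ?_⟩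
      by_contra hlt
      exact (hs j k hj.1 hk).2 hlt (hj.2 k hk)
    · intro hj
      exact ⟨hj.1, fun k hk => (hs j k hj.1 hk).1 hj⟩

/-- The data observed while the minimum utility is raised are tame. -/
theorem tame_raiseMin [Finite R] (hE : EnvyFree V σ r) (F : Set R) (d : R → ℝ) :
    Tame fun s => (EnvyEdge V σ (r + s • d), poorest V σ F (r + s • d),
      atBound noLower (r + s • d) ∪ F, atBound (budgetUpper b σ) (r + s • d) ∪ F) := by
  refine (tame_envyEdge hE d).prodMk ((tame_poorest V σ F r d).prodMk (Tame.prodMk ?_ ?_))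
  · simp only [atBound_noLower]
    exact tame_const _
  · refine Tame.set fun j => ?_
    by_cases hj : j ∈ F
    · simp only [mem_union, hj, or_true]
      exact tame_const _
    · simp only [mem_union, hj, or_false, mem_atBound_add_smul_iff]
      have h := tame_affine_sign (r j - b (σ.symm j) j) (d j)
      refine ⟨?_, fun t ht hs => ?_⟩
      · obtain ⟨⟨c, hc⟩, -⟩ := h
        exact ⟨c.2, hc.mono fun s hs => congrArg Prod.snd hs⟩
      · rcases eq_or_ne (r j - b (σ.symm j) j + t * d j) 0 with h0 | h0
        · have h1 := (iff_of_eq (hs (t / 2) ⟨by linarith, by linarith⟩)).2 h0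
          obtain ⟨h2, h3⟩ := affine_eq_zero ht h1 h0
          exact .of_forall fun s => by simp [h2, h3]
        · rcases h0.lt_or_gt with h0 | h0
          · filter_upwards [eventually_affine_lt h0] with s hs
            simp [hs.ne, h0.ne]
          · filter_upwards [eventually_lt_affine h0] with s hs
            simp [hs.ne', h0.ne']

theorem exists_raiseMinStep [Finite R] (hE : EnvyFree V σ r)
    (hg : RaiseMinGuard V (budgetUpper b σ) σ F r)
    (hbl : blockedPoorest V noLower σ F r = ∅) :
    ∃ r', RaiseMinStep V noLower (budgetUpper b σ) σ F r r' := by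
  have hI := raiseMinGuard_iff.1 hg
  have hX : (poorest V σ F r).Nonempty := poorest_nonempty hg.ne_univ
  have hadm := admissible_free hI hX
  suffices ∃ t, NextEvent (fun q => (EnvyEdge V σ q, poorest V σ F q, atBound noLower q ∪ F,
      atBound (budgetUpper b σ) q ∪ F)) r
      (velocity (free V σ r (poorest V σ F r) (atBound (budgetUpper b σ) r ∪ F))
        (reachTo V σ r (poorest V σ F r))) t by
    obtain ⟨t, ht⟩ := this
    exact ⟨_, hg, hbl, t, ht, rfl⟩
  refine exists_nextEvent (tame_raiseMin hE F _) ?_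
  set d := velocity (free V σ r (poorest V σ F r) (atBound (budgetUpper b σ) r ∪ F))
        (reachTo V σ r (poorest V σ F r)) with hd
  rintro ⟨c, hc⟩
  have hconst : ∀ s > (0 : ℝ), ∀ s' > (0 : ℝ),
      poorest V σ F (r + s • d) = poorest V σ F (r + s' • d) := fun s hs s' hs' =>
    congrArg (fun p => p.2.1) ((hc s hs).trans (hc s' hs').symm)
  obtain ⟨k, hk⟩ := hI
  obtain ⟨m, hm⟩ := hX
  have hmD : m ∈ reachTo V σ r (poorest V σ F r) := subset_reachTo V σ r _ hm
  have hkF : k ∉ F := fun h => (mem_free_iff.1 hk).2 (subset_reachTo V σ r _ (.inr h))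
  have hlt : util V r (σ.symm m) m < util V r (σ.symm k) k := by
    refine lt_of_le_of_ne (hm.2 k hkF) fun h => (mem_free_iff.1 hk).1 (subset_reachTo V σ r _ ?_)
    exact ⟨hkF, fun l hl => h ▸ hm.2 l hl⟩
  have hdk : d k = 1 := velocity_of_mem_inc hadm.disjoint hk
  have hdm : d m < 0 := hadm.velocity_dec_neg hmD
  -- Rooms may leave the poorest set at the onset, so `m` has to be shown to stay in it for a short
  -- time before constancy of the data applies.
  have hsmall : ∀ᶠ s in 𝓝[>] (0 : ℝ), ∀ l ∉ F,
      util V (r + s • d) (σ.symm m) m ≤ util V (r + s • d) (σ.symm l) l := by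
    refine eventually_all.2 fun l => ?_
    rcases (em (l ∈ F)) with hl | hl
    · exact .of_forall fun s h => absurd hl h
    simp only [util_add_smul_le_iff]
    rcases (hm.2 l hl).eq_or_lt with h0 | h0
    · have hlX : l ∈ poorest V σ F r := ⟨hl, fun n hn => h0 ▸ hm.2 n hn⟩
      have : d l = d m := by
        rw [hd, velocity_of_mem_dec hadm.disjoint hmD,
          velocity_of_mem_dec hadm.disjoint (subset_reachTo V σ r _ hlX)]
      exact .of_forall fun s _ => by rw [this]; linarith
    · filter_upwards [eventually_affine_lt (t := 0)
        (a := util V r (σ.symm m) m - util V r (σ.symm l) l) (b := d l - d m) (by linarith)]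
        with s hs _
      exact hs.le
  obtain ⟨s, hs, hs0⟩ := (hsmall.and (eventually_mem_nhdsWithin (s := Ioi (0 : ℝ)))).exists
  have hms : m ∈ poorest V σ F (r + s • d) := ⟨hm.1, hs⟩
  -- The room `k` rises at unit rate while `m` falls, so by this time the occupant of `k` is poorer
  -- than that of `m`.
  set T := util V r (σ.symm k) k - util V r (σ.symm m) m + 1 with hT
  have hT0 : 0 < T := by linarith
  rw [hconst s hs0 T hT0] at hms
  have := hms.2 k hkF
  rw [util_add_smul_le_iff, hdk] at this
  nlinarith

/-- Number of steps left to the procedure that raises the minimum utility, at most. -/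
def raiseMinPotential (V b : A → R → ℝ) (σ : A ≃ R) (F : Set R) (r : R → ℝ) : ℕ :=
  movePotential V σ r (poorest V σ F r) (atBound (budgetUpper b σ) r ∪ F)

/-- All poorest rooms fall at the same rate and stay poorest until the event. The event is a new
edge, a new poorest room, which enlarges the falling set, or a room arriving at its budget, which
shrinks the rising set. -/
theorem RaiseMinStep.invariant [Fintype R] {r' : R → ℝ} (hE : EnvyFree V σ r)
    (hb : ∀ i, r (σ i) ≤ b i (σ i)) (h : RaiseMinStep V noLower (budgetUpper b σ) σ F r r') :
    EnvyFree V σ r' ∧ ∑ j, r' j = ∑ j, r j ∧ (∀ i, r' (σ i) ≤ b i (σ i)) ∧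
      (∀ j ∈ F, r' j = r j) ∧
      (∀ m ∈ poorest V σ F r, ∀ k ∉ F, util V r (σ.symm m) m < util V r' (σ.symm k) k) ∧
      raiseMinPotential V b σ F r' < raiseMinPotential V b σ F r := by
  obtain ⟨hg, hbl, t, ⟨ht, hconst, hne⟩, hr'⟩ := h
  have hI := raiseMinGuard_iff.1 hg
  have hX : (poorest V σ F r).Nonempty := poorest_nonempty hg.ne_univ
  have hadm := admissible_free hI hX
  have hfree : (reachTo V σ r (poorest V σ F r) ∪
      reachTo V σ r (atBound (budgetUpper b σ) r ∪ F))ᶜ =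
    free V σ r (poorest V σ F r) (atBound (budgetUpper b σ) r ∪ F) := rfl
  rw [hfree] at hr' hconst hne
  set X := poorest V σ F r with hXdef
  set Y := atBound (budgetUpper b σ) r ∪ F with hYdef
  set I := free V σ r X Y with hIdef
  set D := reachTo V σ r X with hDdef
  set d := velocity I D with hd
  simp only [Prod.mk.injEq, atBound_noLower, true_and] at hconst hne
  have hYI : ∀ j ∈ Y, j ∉ I := fun j hj hjI =>
    (mem_free_iff.1 hjI).2 (subset_reachTo V σ r _ hj)
  have hXD : X ⊆ D := subset_reachTo V σ r _
  have hb' : ∀ j, r j ≤ b (σ.symm j) j := fun j => by simpa using hb (σ.symm j)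
  -- Frozen rooms do not rise, as they belong to `Y`; a falling one would reach a poorest room,
  -- which would then be blocked.
  have hFd : ∀ j ∈ F, d j = 0 := by
    intro j hj
    refine velocity_of_notMem (hYI j (.inr hj)) ?_
    rintro ⟨m, hm, hjm⟩
    rw [blockedPoorest_noLower] at hbl
    exact notMem_empty m (hbl ▸ (⟨⟨j, hj, hjm⟩, hm⟩ : m ∈ reachFrom V σ r F ∩ X))
  have hYconst : ∀ j, j ∉ F → ∀ s ∈ Ioo 0 t, ∀ s' ∈ Ioo 0 t,
      (j ∈ atBound (budgetUpper b σ) (r + s • d) ↔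
        j ∈ atBound (budgetUpper b σ) (r + s' • d)) := by
    intro j hj s hs s' hs'
    have := (hconst s hs s' hs').2.2
    have h2 : j ∈ atBound (budgetUpper b σ) (r + s • d) ∪ F ↔
      j ∈ atBound (budgetUpper b σ) (r + s' • d) ∪ F := by rw [this]
    simpa [hj] using h2
  have hub : ∀ j, r' j ≤ b (σ.symm j) j := by
    intro j
    rw [hr']
    by_cases hj : j ∈ F
    · rw [add_smul_apply', hFd j hj]
      linarith [hb' j]
    · exact le_bound_of_atBound_const ht.le (hb' j)
        (fun h => hadm.velocity_nonpos (hYI j (.inl (mem_atBound_iff.2 h)))) (hYconst j hj)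
  have hgap : ∀ m ∈ X, ∀ k ∉ F, util V r (σ.symm m) m = util V r (σ.symm k) k → d k = d m := by
    intro m hm k hk h
    have hkX : k ∈ X := ⟨hk, fun n hn => h ▸ hm.2 n hn⟩
    rw [hd, velocity_of_mem_dec hadm.disjoint (hXD hm),
      velocity_of_mem_dec hadm.disjoint (hXD hkX)]
  -- The poorest rooms remain the poorest.
  have hXsmall : ∀ m ∈ X, ∃ s ∈ Ioo 0 t, m ∈ poorest V σ F (r + s • d) := by
    intro m hm
    have hsmall : ∀ᶠ s in 𝓝[>] (0 : ℝ), ∀ l ∉ F,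
        util V (r + s • d) (σ.symm m) m ≤ util V (r + s • d) (σ.symm l) l := by
      refine eventually_all.2 fun l => ?_
      rcases (em (l ∈ F)) with hl | hl
      · exact .of_forall fun s h => absurd hl h
      simp only [util_add_smul_le_iff]
      rcases (hm.2 l hl).eq_or_lt with h0 | h0
      · exact .of_forall fun s _ => by rw [hgap m hm l hl h0]; linarith
      · filter_upwards [eventually_affine_lt (t := 0)
          (a := util V r (σ.symm m) m - util V r (σ.symm l) l) (b := d l - d m) (by linarith)]
          with s hs _
        exact hs.le
    obtain ⟨s, hs, hs0⟩ := (hsmall.and (Ioo_mem_nhdsGT ht)).exists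
    exact ⟨s, hs0, hm.1, hs⟩
  have hXmid : ∀ m ∈ X, ∀ s ∈ Ioo 0 t, m ∈ poorest V σ F (r + s • d) := by
    intro m hm s hs
    obtain ⟨s', hs', hms'⟩ := hXsmall m hm
    rwa [(hconst s hs s' hs').2.1]
  have hXX' : X ⊆ poorest V σ F r' := by
    intro m hm
    refine ⟨hm.1, fun k hk => ?_⟩
    have h1 := (hXmid m hm (t / 2) ⟨by linarith, by linarith⟩).2 k hk
    by_contra hneg
    rw [hr', util_add_smul_le_iff, not_le] at hneg
    set a := util V r (σ.symm m) m - util V r (σ.symm k) k with ha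
    have ha0 : a ≤ 0 := by linarith [hm.2 k hk]
    have hβ : 0 < d k - d m := by
      by_contra h
      nlinarith [not_lt.1 h]
    have hlim : 0 < a + t * (d k - d m) := hneg
    have hs1 : (-a) / (d k - d m) < t := by
      rw [div_lt_iff₀ hβ]
      linarith
    have hs0 : 0 ≤ (-a) / (d k - d m) := div_nonneg (by linarith) hβ.le
    -- If another room were poorer at time `t`, it would be so already at the midpoint between the
    -- tie and `t`.
    have h2 := (hXmid m hm (((-a) / (d k - d m) + t) / 2) ⟨by linarith, by linarith⟩).2 k hk
    rw [util_add_smul_le_iff, ← ha] at h2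
    have h3 : (-a) / (d k - d m) * (d k - d m) = -a := div_mul_cancel₀ _ hβ.ne'
    nlinarith
  have hYY' : Y \ D ⊆ atBound (budgetUpper b σ) r' ∪ F := by
    rintro j ⟨hj, hjD⟩
    rcases hj with hjB | hjF
    · left
      rw [hr', mem_atBound_add_smul_iff, hd, velocity_of_notMem (hYI j (.inl hjB)) hjD]
      rw [mem_atBound_iff] at hjB
      linarith
    · exact .inr hjF
  refine ⟨?_, ?_, ?_, ?_, ?_, ?_⟩
  · rw [hr']
    exact hE.add_smul ht.le (fun x y => hadm.velocity_le_of_edge)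
      fun s hs s' hs' => (hconst s hs s' hs').1
  · rw [hr']
    exact hadm.sum_add_smul t
  · intro i
    simpa using hub (σ i)
  · intro j hj
    rw [hr', add_smul_apply', hFd j hj, mul_zero, add_zero]
  · intro m hm k hk
    refine lt_of_lt_of_le ?_ ((hXX' hm).2 k hk)
    rw [hr', util_add_smul]
    nlinarith [hadm.velocity_dec_neg (hXD hm)]
  · refine movePotential_lt hI hX hXX' hYY' hr' ?_
    have hs : t / 2 ∈ Ioo 0 t := ⟨by linarith, by linarith⟩
    by_cases h1 : EnvyEdge V σ (r + (t / 2) • d) = EnvyEdge V σ r'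
    swap
    · exact exists_change_of_edge hE hI hX hXX' hYY' hs hd hr' h1
    by_cases h2 : poorest V σ F (r + (t / 2) • d) = poorest V σ F r'
    swap
    · right
      obtain ⟨j, hj⟩ : ∃ j, ¬ (j ∈ poorest V σ F (r + (t / 2) • d) ↔ j ∈ poorest V σ F r') := by
        by_contra! h
        exact h2 (Set.ext h)
      obtain ⟨m, hm⟩ := hX
      have hjF : j ∉ F := by
        intro hjF
        exact hj (iff_of_false (fun h => h.1 hjF) fun h => h.1 hjF)
      have hjX : j ∉ X := fun hjX => hj (iff_of_true (hXmid j hjX _ hs) (hXX' hjX))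
      have hlt : util V r (σ.symm m) m < util V r (σ.symm j) j :=
        lt_of_le_of_ne (hm.2 j hjF) fun h => hjX ⟨hjF, fun n hn => h ▸ hm.2 n hn⟩
      -- Ties with `m` at two distinct times would be ties from the start.
      have hmid : j ∉ poorest V σ F (r + (t / 2) • d) := by
        intro hmid
        have h3 := hmid.2 m hm.1
        have h4 : j ∈ poorest V σ F (r + (t / 4) • d) := by
          rwa [(hconst (t / 4) ⟨by linarith, by linarith⟩ (t / 2) hs).2.1]
        have h5 := h4.2 m hm.1
        have h6 := (hXmid m hm (t / 4) ⟨by linarith, by linarith⟩).2 j hjF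
        have h7 := (hXmid m hm (t / 2) hs).2 j hjF
        rw [util_add_smul_le_iff] at h3 h5 h6 h7
        linarith
      have hj' : j ∈ poorest V σ F r' := by
        by_contra h
        exact hj (iff_of_false hmid h)
      refine ⟨j, fun hjD => ?_, subset_reachTo V σ r' _ hj'⟩
      -- A falling room keeps its distance from `m`, so the newcomer was not falling.
      have h3 := hj'.2 m hm.1
      rw [hr', util_add_smul_le_iff, hd, velocity_of_mem_dec hadm.disjoint (hXD hm),
        velocity_of_mem_dec hadm.disjoint hjD] at h3
      linarith
    have h3 : atBound (budgetUpper b σ) (r + (t / 2) • d) ∪ F ≠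
        atBound (budgetUpper b σ) r' ∪ F := by
      intro h3
      have := hne (t / 2) hs
      rw [← hr'] at this
      exact this (by rw [h1, h2, h3])
    obtain ⟨j, hj⟩ : ∃ j, ¬ (j ∈ atBound (budgetUpper b σ) (r + (t / 2) • d) ∪ F ↔
        j ∈ atBound (budgetUpper b σ) r' ∪ F) := by
      by_contra! h
      exact h3 (Set.ext h)
    have hjF : j ∉ F := fun hjF => hj (iff_of_true (.inr hjF) (.inr hjF))
    simp only [mem_union, hjF, or_false] at hj
    have hj' : j ∈ atBound (budgetUpper b σ) r' := by
      by_contra hj'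
      simp only [hj', iff_false, not_not] at hj
      have h4 := (hYconst j hjF (t / 2) hs (t / 4) ⟨by linarith, by linarith⟩).1 hj
      rw [mem_atBound_add_smul_iff] at hj h4
      rw [hr', mem_atBound_add_smul_iff] at hj'
      exact hj' (by linarith)
    refine .inl ⟨j, ?_, fun h => (mem_free_iff.1 h).2 (subset_reachTo V σ r' _ (.inl hj'))⟩
    by_contra hjI
    have hjd := hadm.velocity_nonpos hjI
    rw [← hd] at hjd
    have h5 := mem_atBound_iff.1 hj'
    have h7 : d j = 0 := by
      rw [hr', add_smul_apply'] at h5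
      nlinarith [hb' j]
    rw [hr', mem_atBound_add_smul_iff, mem_atBound_add_smul_iff, h7] at hj
    simp at hj

end RaiseMin

/-! ### Comparing sorted utility vectors -/

section Lexicographic

/-- The sorted lists share their entries below `x`. After these `L` has more copies of `x`, so at
the first difference it has `x` where `L'` has something larger. -/
theorem lex_of_count {x : ℝ} : ∀ {L L' : List ℝ}, L.length = L'.length → L.Pairwise (· ≤ ·) →
    L'.Pairwise (· ≤ ·) → (∀ y < x, L.count y = L'.count y) → L'.count x < L.count x →
    List.Lex (· < ·) L L'
  | [], _, _, _, _, _, h => by simp at h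
  | _ :: _, [], h, _, _, _, _ => by simp at h
  | a :: l, c :: l', hlen, hL, hL', heq, hlt => by
    have hax : a ≤ x := by
      have hx : x ∈ a :: l := List.count_pos_iff.1 (by omega)
      rcases List.mem_cons.1 hx with h | h
      · exact h.ge
      · exact (List.pairwise_cons.1 hL).1 x h
    rcases lt_trichotomy a c with h | h | h
    · exact .rel h
    · subst h
      refine .cons (lex_of_count (x := x) (by simpa using hlen) hL.of_cons hL'.of_cons
        (fun y hy => ?_) ?_)
      · have := heq y hy
        simp only [List.count_cons] at this
        omega
      · simp only [List.count_cons] at hlt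
        omega
    · exfalso
      have h1 := heq c (h.trans_le hax)
      have h2 : c ∈ a :: l := List.count_pos_iff.1 (by rw [h1]; simp)
      rcases List.mem_cons.1 h2 with h3 | h3
      · exact h.ne h3
      · exact absurd ((List.pairwise_cons.1 hL).1 c h3) (not_le.2 h)

variable {A R : Type*} [Fintype A] {V : A → R → ℝ} {σ : A ≃ R} {r s : R → ℝ} {F : Set R}

/-- If two rents agree on `F` and the smallest utility outside `F` is smaller at `s`, then the sorted
utility vector at `s` is lexicographically smaller. -/
theorem sortedUtils_lt [Finite R] (hF : ∀ j ∈ F, s j = r j) {k : R} (hk : k ∉ F)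
    (hlt : ∀ j ∉ F, util V s (σ.symm k) k < util V r (σ.symm j) j) :
    sortedUtils V (σ, s) < sortedUtils V (σ, r) := by
  classical
  obtain ⟨m, hm⟩ : (poorest V σ F s).Nonempty := poorest_nonempty fun h => hk (h ▸ mem_univ k)
  have hm' : ∀ i, σ i ∉ F → util V s (σ.symm m) m < utilOf V (σ, r) i := by
    intro i hi
    have := hlt (σ i) hi
    rw [Equiv.symm_apply_apply] at this
    exact (hm.2 k hk).trans_lt this
  have hms : ∀ i, σ i ∉ F → util V s (σ.symm m) m ≤ utilOf V (σ, s) i := by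
    intro i hi
    have := hm.2 (σ i) hi
    rwa [Equiv.symm_apply_apply] at this
  have heq : ∀ i, σ i ∈ F → utilOf V (σ, s) i = utilOf V (σ, r) i := by
    intro i hi
    simp only [utilOf, util, hF _ hi]
  have hmm : utilOf V (σ, s) (σ.symm m) = util V s (σ.symm m) m := by simp [utilOf]
  have hcount : ∀ (p : (A ≃ R) × (R → ℝ)) (y : ℝ), (sortedUtils V p).count y =
      (Finset.univ.filter fun i => y = utilOf V p i).card := by
    intro p y
    rw [← Multiset.coe_count, sortedUtils, Multiset.sort_eq, Multiset.count_map]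
    rfl
  -- Agents in `F` contribute equally to both vectors. The others have utility at least `x` at `s`,
  -- attained by the occupant of `m`, and more than `x` at `r`.
  refine lex_of_count (x := util V s (σ.symm m) m) ?_ ?_ ?_ ?_ ?_
  · simp [sortedUtils]
  · exact Multiset.pairwise_sort _ _
  · exact Multiset.pairwise_sort _ _
  · intro y hy
    rw [hcount, hcount]
    congr 1
    ext i
    by_cases hi : σ i ∈ F
    · simp [heq i hi]
    · simp only [Finset.mem_filter_univ]
      exact iff_of_false (hy.trans_le (hms i hi)).ne (hy.trans (hm' i hi)).ne
  · rw [hcount, hcount]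
    refine Finset.card_lt_card ((Finset.ssubset_iff_of_subset fun i hi => ?_).2
      ⟨σ.symm m, by simp [hmm], fun h => ?_⟩)
    · by_cases hiF : σ i ∈ F
      · simpa [heq i hiF] using hi
      · rw [Finset.mem_filter_univ] at hi
        exact absurd hi (hm' i hiF).ne
    · rw [Finset.mem_filter_univ] at h
      exact absurd h (hm' _ (by simpa using hm.1)).ne

end Lexicographic

/-! ### Optimality of the rents on termination -/

section Optimality

variable {A R : Type*} {V b : A → R → ℝ} {σ : A ≃ R} {r s : R → ℝ}

theorem le_rent_of_mem_reachTo_atBound (hs : EnvyFree V σ s) (hb : ∀ i, s (σ i) ≤ b i (σ i))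
    {x : R} (hx : x ∈ reachTo V σ r (atBound (budgetUpper b σ) r)) : s x ≤ r x := by
  refine hs.le_of_mem_reachTo (fun y hy => ?_) hx
  rw [mem_atBound_iff.1 hy]
  simpa using hb (σ.symm y)

theorem minUtil_eq_of_mem_poorest [Finite A] {m : R} (hm : m ∈ poorest V σ ∅ r) :
    minUtil V (σ, r) = util V r (σ.symm m) m := by
  have hA : Nonempty A := ⟨σ.symm m⟩
  apply le_antisymm
  · simpa [utilOf] using minUtil_le V (σ, r) (σ.symm m)
  · refine le_ciInf fun i => ?_
    simpa [utilOf] using hm.2 (σ i) (notMem_empty _)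

variable [Fintype A]

/-- If the minimum utility cannot be raised by moving rents, then at other rents the maximum utility
has not decreased by more than the minimum utility has. -/
theorem maxUtil_le_of_not_raiseMinGuard [Finite R] [Nonempty R]
    (hg : ¬ RaiseMinGuard V (budgetUpper b σ) σ ∅ r) (hs : EnvyFree V σ s)
    (hb : ∀ i, s (σ i) ≤ b i (σ i)) :
    maxUtil V (σ, r) ≤ maxUtil V (σ, s) ∨
      ∃ δ, maxUtil V (σ, r) + δ ≤ maxUtil V (σ, s) ∧ minUtil V (σ, s) ≤ minUtil V (σ, r) + δ := by
  rw [not_raiseMinGuard_iff, union_empty] at hg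
  have hA : Nonempty A := σ.nonempty
  obtain ⟨i, hi⟩ := exists_eq_ciSup_of_finite (f := utilOf V (σ, r))
  have hmax : maxUtil V (σ, r) = util V r i (σ i) := hi.symm
  have hs1 := le_maxUtil V (σ, s) i
  -- The room of a richest agent reaches a poorest room `y`, whose rent change then bounds its own
  -- from above, or a room at its bound, in which case its rent cannot increase.
  rcases hg (σ i) with ⟨y, hy, hiy⟩ | hx
  · right
    refine ⟨r y - s y, ?_, ?_⟩
    · have := hs.sub_le_sub_of_reach hiy
      simp only [hmax, utilOf, util] at *
      linarith
    · have := minUtil_le V (σ, s) (σ.symm y)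
      rw [minUtil_eq_of_mem_poorest hy]
      simp only [utilOf, util, Equiv.apply_symm_apply] at *
      linarith
  · left
    have := le_rent_of_mem_reachTo_atBound hs hb hx
    simp only [hmax, utilOf, util] at *
    linarith

variable [Fintype R]

/-- If the minimum utility cannot be raised by moving rents, then it is the largest possible. -/
theorem minUtil_le_of_not_raiseMinGuard [Nonempty R]
    (hg : ¬ RaiseMinGuard V (budgetUpper b σ) σ ∅ r) (hs : EnvyFree V σ s)
    (hsum : ∑ j, s j = ∑ j, r j) (hb : ∀ i, s (σ i) ≤ b i (σ i)) :
    minUtil V (σ, s) ≤ minUtil V (σ, r) := by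
  rw [not_raiseMinGuard_iff, union_empty] at hg
  obtain ⟨m, hm⟩ : (poorest V σ ∅ r).Nonempty := poorest_nonempty empty_ne_univ
  by_contra! hlt
  have hpoor : ∀ y ∈ poorest V σ ∅ r, s y < r y := by
    intro y hy
    rw [minUtil_eq_of_mem_poorest hy] at hlt
    have := hlt.trans_le (minUtil_le V (σ, s) (σ.symm y))
    simp only [utilOf, Equiv.apply_symm_apply, util] at this
    linarith
  -- With a larger minimum utility all poorest rooms are strictly cheaper, and then no room can make
  -- up for the loss of rent.
  have hle : ∀ x, s x ≤ r x := by
    intro x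
    rcases hg x with hx | hx
    · exact hs.le_of_mem_reachTo (fun y hy => (hpoor y hy).le) hx
    · exact le_rent_of_mem_reachTo_atBound hs hb hx
  have := Finset.sum_lt_sum (fun j _ => hle j) ⟨m, Finset.mem_univ m, hpoor m hm⟩
  linarith

/-- All ways to make the sorted utility vector lexicographically at least as large keep the rents in
`F`. -/
def Fixed (V b : A → R → ℝ) (Rt : ℝ) (σ : A ≃ R) (r : R → ℝ) (F : Set R) : Prop :=
  ∀ s, (σ, s) ∈ EFb V b Rt → ¬ sortedUtils V (σ, s) < sortedUtils V (σ, r) → ∀ j ∈ F, s j = r j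

/-- A higher rent in a poorest room would push its occupant below all utilities outside `F` at `r`,
making `s` lexicographically worse. -/
theorem util_le_of_not_lt {F : Set R} (hF : ∀ j ∈ F, s j = r j)
    (hlt : ¬ sortedUtils V (σ, s) < sortedUtils V (σ, r)) {y : R} (hy : y ∈ poorest V σ F r) :
    s y ≤ r y := by
  by_contra! h
  refine hlt (sortedUtils_lt hF hy.1 fun j hj => lt_of_lt_of_le ?_ (hy.2 j hj))
  simp only [util]
  linarith

/-- A path from a frozen room forbids a lower rent in a blocked room; being poorest forbids a higher
one. -/
theorem Fixed.freeze {Rt : ℝ} {F : Set R} (h : Fixed V b Rt σ r F) :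
    Fixed V b Rt σ r (F ∪ blockedPoorest V noLower σ F r) := by
  rw [blockedPoorest_noLower]
  intro s hs hlt j hj
  have hF := h s hs hlt
  rcases hj with hj | ⟨⟨x, hx, hxj⟩, hj⟩
  · exact hF j hj
  · have h1 := EnvyFree.sub_le_sub_of_reach (mem_EFb_iff.1 hs).1 hxj
    have h2 := util_le_of_not_lt hF hlt hj
    rw [hF x hx, sub_self] at h1
    linarith

theorem Fixed.step {Rt : ℝ} {F : Set R} {r' : R → ℝ} (h : Fixed V b Rt σ r F)
    (hlt : sortedUtils V (σ, r) < sortedUtils V (σ, r')) (hF : ∀ j ∈ F, r' j = r j) :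
    Fixed V b Rt σ r' F := by
  intro s hs hs' j hj
  rw [hF j hj]
  exact h s hs (fun h' => hs' (h'.trans hlt)) j hj

/-- A lexicographically better competitor would have rents at most `r` everywhere, and by the equal
totals it would be `r` itself. -/
theorem Fixed.not_lt {Rt : ℝ} {F : Set R} (h : Fixed V b Rt σ r F) (hr : ∑ j, r j = Rt)
    (hg : ¬ RaiseMinGuard V (budgetUpper b σ) σ F r) (hs : (σ, s) ∈ EFb V b Rt) :
    ¬ sortedUtils V (σ, r) < sortedUtils V (σ, s) := by
  rw [not_raiseMinGuard_iff] at hg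
  intro hlt
  have hF := h s hs hlt.not_gt
  obtain ⟨hE, hsum, hb⟩ := mem_EFb_iff.1 hs
  have hle : ∀ x, s x ≤ r x := by
    intro x
    rcases hg x with hx | hx
    · exact hE.le_of_mem_reachTo (fun y hy => util_le_of_not_lt hF hlt.not_gt hy) hx
    · refine hE.le_of_mem_reachTo (fun y hy => ?_) hx
      rcases hy with hy | hy
      · rw [mem_atBound_iff.1 hy]
        simpa using hb (σ.symm y)
      · exact (hF y hy).le
  have heq := (Finset.sum_eq_sum_iff_of_le fun j _ => hle j).1 (hsum.trans hr.symm)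
  have : s = r := funext fun j => heq j (Finset.mem_univ j)
  rw [this] at hlt
  exact lt_irrefl _ hlt

end Optimality

/-! ### Invariant and potential of the whole algorithm -/

section Invariant

theorem raiseMinPotential_le {A R : Type*} [Fintype R] {V b : A → R → ℝ} {μ : A ≃ R} {F : Set R}
    {r : R → ℝ} :
    raiseMinPotential V b μ F r ≤ 2 * Fintype.card R := movePotential_le

theorem blockedPoorest_empty {A R : Type*} {V : A → R → ℝ} {μ : A ≃ R} {r : R → ℝ} :
    blockedPoorest V noLower μ ∅ r = ∅ := by
  rw [blockedPoorest_noLower, reachFrom_empty, empty_inter]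

/-- If the minimum utility cannot be raised, then some richest room cannot get more expensive. -/
theorem blockedRichest_nonempty {A R : Type*} [Finite R] {V b : A → R → ℝ} {μ : A ≃ R} {r : R → ℝ}
    (hg : ¬ RaiseMinGuard V (budgetUpper b μ) μ ∅ r)
    (hL : LowerMaxGuard V noLower μ (poorest V μ ∅ r) r) :
    (blockedRichest V (budgetUpper b μ) μ (poorest V μ ∅ r) r).Nonempty := by
  have hne : poorest V μ ∅ r ≠ univ := by
    intro h
    apply hL
    rw [h, union_univ, Set.eq_univ_iff_forall]
    exact fun x => .inl (subset_reachFrom V μ r _ (mem_univ x))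
  obtain ⟨m, hm⟩ := richest_nonempty (V := V) (σ := μ) (r := r) hne
  refine ⟨m, ?_, hm⟩
  rw [not_raiseMinGuard_iff, union_empty] at hg
  rcases hg m with ⟨y, hy, h⟩ | ⟨y, hy, h⟩
  · exact ⟨y, .inr hy, h⟩
  · exact ⟨y, .inl hy, h⟩

variable {A R : Type*} [Fintype R]

/-- The assignment `μ` is feasible at the rents of all feasible allocations. -/
def Supports (V b : A → R → ℝ) (Rt : ℝ) (μ : A ≃ R) : Prop :=
  ∀ p ∈ EFb V b Rt, (μ, p.2) ∈ EFb V b Rt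

/-- The assignment `f` combined from the components that are not in `todo` any more: it is envy-free
at `r`, respects the components, and satisfies, in the treated components, the budgets at the rents
of all feasible allocations. -/
structure Combined (V b : A → R → ℝ) (Rt : ℝ) (σ : A ≃ R) (r : R → ℝ) (todo : Set (Set R))
    (f : A → R) : Prop where
  envyFree : EnvyFree V σ r
  subset : todo ⊆ components V σ r
  injective : Function.Injective f
  util_eq : ∀ i, util V r i (f i) = util V r i (σ i)
  conn : ∀ i, Conn V σ r (σ i) (f i)
  le_budget : ∀ i, (∀ C ∈ todo, σ i ∉ C) → ∀ p ∈ EFb V b Rt, p.2 (f i) ≤ b i (f i)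

/-- The invariant of the algorithm. -/
def Invariant [Fintype A] (V b : A → R → ℝ) (Rt : ℝ) (o : Objective) : State A R → Prop
  | .start => True
  | .components σ todo f => ∃ r, Combined V b Rt σ r todo f
  | .maxRent σ todo f C ρ q => ∃ r, Combined V b Rt σ r (insert C todo) f ∧ C ∉ todo ∧
      EnvyFree (restrict V σ C) ρ q ∧ ∀ i, q (ρ i) ≤ restrict b σ C i (ρ i)
  | .bounds μ r => (μ, r) ∈ EF V Rt ∧ Supports V b Rt μ
  | .maximin μ r => (μ, r) ∈ EFb V b Rt ∧ Supports V b Rt μ ∧ (o = .maximin ∨ o = .minSpread)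
  | .leximin μ r F => (μ, r) ∈ EFb V b Rt ∧ Supports V b Rt μ ∧ Fixed V b Rt μ r F ∧ o = .leximin
  | .minimax μ r F => (μ, r) ∈ EFb V b Rt ∧ Supports V b Rt μ ∧
      ¬ RaiseMinGuard V (budgetUpper b μ) μ ∅ r ∧ F = poorest V μ ∅ r ∧ o = .minSpread
  | .noSolution => EFb V b Rt = ∅
  | .done μ r => (μ, r) ∈ EFb V b Rt ∧ o.IsOptimal V (EFb V b Rt) (μ, r)

/-- Bound on the passes through the loop of the maximum-rent procedure, for `n` rooms. -/
def maxRentBound (n : ℕ) : ℕ := (n + 1) * (n * n) + n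

/-- Bound on the steps of the fair-rent procedures, for `n` rooms. -/
def fairBound (n : ℕ) : ℕ := (n + 1) * (2 * n + 1) + 2

/-- Bound on the steps after the components have been treated, for `n` rooms. -/
def combineBound (n : ℕ) : ℕ := fairBound n + ((2 * n + 1) * n + 2 * n) + 2

/-- Number of steps left to the algorithm, at most. -/
def potential (V b : A → R → ℝ) : State A R → ℕ
  | .start => Fintype.card R * (maxRentBound (Fintype.card R) + 2) +
      combineBound (Fintype.card R) + 1
  | .components _ todo _ =>
      todo.ncard * (maxRentBound (Fintype.card R) + 2) + combineBound (Fintype.card R)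
  | .maxRent σ todo _ C ρ q =>
      todo.ncard * (maxRentBound (Fintype.card R) + 2) + combineBound (Fintype.card R) + 1 +
        maxRentPotential (restrict b σ C) ρ q
  | .bounds μ r => fairBound (Fintype.card R) + 1 + boundsPotential V b μ r
  | .maximin μ r => raiseMinPotential V b μ ∅ r + 2
  | .leximin μ r F => Fᶜ.ncard * (2 * Fintype.card R + 1) + raiseMinPotential V b μ F r + 1
  | .minimax _ _ _ => 1
  | .noSolution => 0
  | .done _ _ => 0

variable [Fintype A] {V b : A → R → ℝ} {Rt : ℝ} {o : Objective}

theorem Supports.utilOf_eq {μ : A ≃ R} (h : Supports V b Rt μ) {p : (A ≃ R) × (R → ℝ)}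
    (hp : p ∈ EFb V b Rt) : utilOf V p = utilOf V (μ, p.2) :=
  utilOf_congr hp.1.1 (h p hp).1.1

theorem Supports.minUtil_eq {μ : A ≃ R} (h : Supports V b Rt μ) {p : (A ≃ R) × (R → ℝ)}
    (hp : p ∈ EFb V b Rt) : minUtil V p = minUtil V (μ, p.2) := by
  simp only [minUtil, h.utilOf_eq hp]

theorem Supports.maxUtil_eq {μ : A ≃ R} (h : Supports V b Rt μ) {p : (A ≃ R) × (R → ℝ)}
    (hp : p ∈ EFb V b Rt) : maxUtil V p = maxUtil V (μ, p.2) := by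
  simp only [maxUtil, h.utilOf_eq hp]

theorem Supports.sortedUtils_eq {μ : A ≃ R} (h : Supports V b Rt μ) {p : (A ≃ R) × (R → ℝ)}
    (hp : p ∈ EFb V b Rt) : sortedUtils V p = sortedUtils V (μ, p.2) := by
  simp only [sortedUtils, h.utilOf_eq hp]

theorem isMaximin_of_not_raiseMinGuard [Nonempty R] {μ : A ≃ R} {r : R → ℝ}
    (hμ : Supports V b Rt μ) (hr : (μ, r) ∈ EFb V b Rt)
    (hg : ¬ RaiseMinGuard V (budgetUpper b μ) μ ∅ r) : IsMaximin V (EFb V b Rt) (μ, r) := by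
  refine ⟨hr, fun p hp => ?_⟩
  rw [hμ.minUtil_eq hp]
  obtain ⟨hE, hsum, hb⟩ := mem_EFb_iff.1 (hμ p hp)
  exact minUtil_le_of_not_raiseMinGuard hg hE (hsum.trans (mem_EFb_iff.1 hr).2.1.symm) hb

theorem isMinAbsSpread_of_not_raiseMinGuard [Nonempty R] {μ : A ≃ R} {r : R → ℝ}
    (hμ : Supports V b Rt μ) (hr : (μ, r) ∈ EFb V b Rt)
    (hg : ¬ RaiseMinGuard V (budgetUpper b μ) μ ∅ r) : IsMinAbsSpread V (EFb V b Rt) (μ, r) := by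
  refine ⟨hr, fun p hp => ?_⟩
  have hmin := (isMaximin_of_not_raiseMinGuard hμ hr hg).2 p hp
  obtain ⟨hE, -, hb⟩ := mem_EFb_iff.1 (hμ p hp)
  rw [hμ.maxUtil_eq hp]
  rw [hμ.minUtil_eq hp] at hmin ⊢
  rcases maxUtil_le_of_not_raiseMinGuard hg hE hb with h | ⟨δ, h1, h2⟩ <;> linarith

/-- Either the competitor's maximum is no smaller, and its minimum no larger; or its maximum lies at
most `-δ` below and its minimum at least `-δ` below. Lowering the two ends of a positive range by
the same amount does not decrease their ratio. -/
theorem isMinRelSpread_of_not_raiseMinGuard [Nonempty R] {μ : A ≃ R} {r : R → ℝ}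
    (hμ : Supports V b Rt μ) (hr : (μ, r) ∈ EFb V b Rt)
    (hg : ¬ RaiseMinGuard V (budgetUpper b μ) μ ∅ r) : IsMinRelSpread V (EFb V b Rt) (μ, r) := by
  have hA : Nonempty A := μ.nonempty
  refine ⟨hr, fun p hp hpos => ?_⟩
  have hmin := (isMaximin_of_not_raiseMinGuard hμ hr hg).2 p hp
  obtain ⟨hE, -, hb⟩ := mem_EFb_iff.1 (hμ p hp)
  rw [hμ.maxUtil_eq hp]
  rw [hμ.minUtil_eq hp] at hmin hpos ⊢
  have hpos' := hpos.trans_le hmin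
  refine ⟨hpos', ?_⟩
  rw [div_le_div_iff₀ hpos' hpos]
  have hle : ∀ q, minUtil V q ≤ maxUtil V q := fun q =>
    (minUtil_le V q hA.some).trans (le_maxUtil V q hA.some)
  have h1 := hle (μ, r)
  have h2 := hle (μ, p.2)
  have key : maxUtil V (μ, r) ≤ maxUtil V (μ, p.2) →
      maxUtil V (μ, r) * minUtil V (μ, p.2) ≤ maxUtil V (μ, p.2) * minUtil V (μ, r) := fun h =>
    mul_le_mul h hmin hpos.le (by linarith)
  rcases maxUtil_le_of_not_raiseMinGuard hg hE hb with h | ⟨δ, h3, h4⟩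
  · exact key h
  · rcases le_or_gt 0 δ with hδ | hδ
    · exact key (by linarith)
    · calc _ ≤ maxUtil V (μ, r) * (minUtil V (μ, r) + δ) := by
            apply mul_le_mul_of_nonneg_left h4; linarith
        _ ≤ (maxUtil V (μ, r) + δ) * minUtil V (μ, r) := by nlinarith
        _ ≤ _ := mul_le_mul_of_nonneg_right h3 hpos'.le

theorem isLeximin_of_fixed {μ : A ≃ R} {r : R → ℝ} {F : Set R}
    (hμ : Supports V b Rt μ) (hr : (μ, r) ∈ EFb V b Rt) (hF : Fixed V b Rt μ r F)
    (hg : ¬ RaiseMinGuard V (budgetUpper b μ) μ F r) : IsLeximin V (EFb V b Rt) (μ, r) := by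
  refine ⟨hr, fun p hp => ?_⟩
  rw [hμ.sortedUtils_eq hp]
  exact hF.not_lt (mem_EFb_iff.1 hr).2.1 hg (hμ p hp)

theorem combined_initial {A R : Type*} [Fintype R] {V b : A → R → ℝ} {Rt : ℝ}
    {σ : A ≃ R} {r : R → ℝ} (h : EnvyFree V σ r) :
    Combined V b Rt σ r (components V σ r) σ where
  envyFree := h
  subset := subset_rfl
  injective := σ.injective
  util_eq _ := rfl
  conn _ := ⟨.refl, .refl⟩
  le_budget i hi := hi _ ⟨σ i, rfl⟩ ⟨.refl, .refl⟩ |>.elim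

/-- As `f` respects components, its values outside the treated component do not collide with those
of `ρ`. -/
theorem Combined.overwrite {σ : A ≃ R} {r : R → ℝ} {todo : Set (Set R)} {f : A → R} {C : Set R}
    (h : Combined V b Rt σ r (insert C todo) f)
    {ρ : {i : A // σ i ∈ C} ≃ {j : R // j ∈ C}} {q : {j : R // j ∈ C} → ℝ}
    (hρ : EnvyFree (restrict V σ C) ρ q) (hb : ∀ i, q (ρ i) ≤ restrict b σ C i (ρ i))
    (hg : ¬ MaxRentGuard (restrict V σ C) (restrict b σ C) ρ q) :
    Combined V b Rt σ r todo (overwrite σ f C ρ) := by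
  classical
  have hC : C ∈ components V σ r := h.subset (mem_insert C todo)
  have h1 : ∀ i (hi : σ i ∈ C), RentDivision.overwrite σ f C ρ i = ρ ⟨i, hi⟩ := fun i hi => by
    simp [RentDivision.overwrite, hi]
  have h2 : ∀ i, σ i ∉ C → RentDivision.overwrite σ f C ρ i = f i := fun i hi => by
    simp [RentDivision.overwrite, hi]
  have hf : ∀ i, σ i ∉ C → f i ∉ C := fun i hi hfi =>
    hi ((mem_component_iff_of_conn hC (h.conn i)).2 hfi)
  refine ⟨h.envyFree, (subset_insert C todo).trans h.subset, fun i k hik => ?_, fun i => ?_,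
    fun i => ?_, fun i hi p hp => ?_⟩
  · by_cases hi : σ i ∈ C <;> by_cases hk : σ k ∈ C
    · rw [h1 i hi, h1 k hk] at hik
      exact congrArg Subtype.val (ρ.injective (Subtype.ext hik))
    · rw [h1 i hi, h2 k hk] at hik
      exact absurd (hik ▸ (ρ ⟨i, hi⟩).2) (hf k hk)
    · rw [h2 i hi, h1 k hk] at hik
      exact absurd (hik ▸ (ρ ⟨k, hk⟩).2) (hf i hi)
    · rw [h2 i hi, h2 k hk] at hik
      exact h.injective hik
  · by_cases hi : σ i ∈ C
    · rw [h1 i hi]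
      exact (h.envyFree.component C).util_eq hρ ⟨i, hi⟩
    · rw [h2 i hi]
      exact h.util_eq i
  · by_cases hi : σ i ∈ C
    · rw [h1 i hi]
      exact conn_of_mem_component hC hi (ρ ⟨i, hi⟩).2
    · rw [h2 i hi]
      exact h.conn i
  · by_cases hC' : σ i ∈ C
    · rw [h1 i hC']
      obtain ⟨hE, -, hb'⟩ := mem_EFb_iff.1 (show (p.1, p.2) ∈ EFb V b Rt from hp)
      exact le_budget_of_component h.envyFree hC hρ hb hg hE hb' ⟨i, hC'⟩
    · rw [h2 i hC']
      refine h.le_budget i (fun D hD => ?_) p hp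
      rcases mem_insert_iff.1 hD with rfl | hD
      · exact hC'
      · exact hi D hD

/-- From here on the assignment is fixed: competitors may be assumed to use `μ` as well, with
unchanged utilities. -/
theorem Combined.supports {σ μ : A ≃ R} {r s : R → ℝ} {f : A → R}
    (h : Combined V b Rt σ r ∅ f) (hf : ∀ i, μ i = f i) (hμ : EnvyFree V μ s) :
    Supports V b Rt μ := by
  intro p hp
  obtain ⟨hE, hsum, -⟩ := mem_EFb_iff.1 (show (p.1, p.2) ∈ EFb V b Rt from hp)
  refine mem_EFb_iff.2 ⟨hE.transfer hμ, hsum, fun i => ?_⟩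
  rw [hf]
  exact h.le_budget i (fun C hC => absurd hC (notMem_empty C)) p hp

theorem maxRentPotential_le_bound {σ : A ≃ R} {C : Set R}
    (ρ : {i : A // σ i ∈ C} ≃ {j : R // j ∈ C}) (q : {j : R // j ∈ C} → ℝ) :
    maxRentPotential (restrict b σ C) ρ q ≤ maxRentBound (Fintype.card R) := by
  have h1 : Nat.card {j : R // j ∈ C} ≤ Fintype.card R := by
    rw [← Nat.card_eq_fintype_card]
    exact Nat.card_le_card_of_injective _ Subtype.val_injective
  have h2 : Nat.card {i : A // σ i ∈ C} ≤ Fintype.card R := (Nat.card_congr ρ).trans_le h1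
  refine (maxRentPotential_le _ _ _).trans ?_
  unfold maxRentBound
  gcongr

/-- Each step preserves the invariant and decreases the potential. -/
theorem Step.invariant [Nonempty R] {s s' : State A R} (h : Step V b Rt o s s')
    (hs : Invariant V b Rt o s) :
    Invariant V b Rt o s' ∧ potential V b s' < potential V b s := by
  cases h with
  | init R' σ r h =>
    refine ⟨⟨r, combined_initial h.1⟩, Nat.lt_succ_of_le ?_⟩
    have : (components V σ r).ncard ≤ Fintype.card R := by
      rw [← Nat.card_eq_fintype_card, ← Set.ncard_univ, components, ← Set.image_univ]
      exact Set.ncard_image_le (Set.toFinite _)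
    exact Nat.add_le_add_right (Nat.mul_le_mul_right _ this) _
  | enter σ todo f C hC R' Δ ρ q h hΔ ht =>
    obtain ⟨r, hr⟩ := hs
    have hE := hΔ.1.1
    have hb := hΔ.2
    refine ⟨⟨r, ?_, fun h => h.2 rfl, hE, hb⟩, ?_⟩
    · rwa [insert_sdiff_singleton, insert_eq_of_mem hC]
    · have h1 := maxRentPotential_le_bound (b := b) ρ fun j => q j - Δ
      have h2 := Set.ncard_sdiff_singleton_add_one hC (Set.toFinite todo)
      simp only [potential]
      rw [← h2, add_mul]
      omega
  | maxRentLoop σ todo f C ρ ρ' q q' h =>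
    obtain ⟨r, hr, hC, hE, hb⟩ := hs
    obtain ⟨h1, h2, h3⟩ := h.invariant hE hb
    exact ⟨⟨r, hr, hC, h1, h2⟩, Nat.add_lt_add_left h3 _⟩
  | maxRentExit σ todo f C ρ q h =>
    obtain ⟨r, hr, hC, hE, hb⟩ := hs
    refine ⟨⟨r, hr.overwrite hE hb h⟩, ?_⟩
    simp only [potential]
    omega
  | combine σ todo f μ r hC hf h =>
    subst hC
    obtain ⟨r', hr⟩ := hs
    refine ⟨⟨h, hr.supports hf h.1⟩, ?_⟩
    have := boundsPotential_le (V := V) (b := b) (σ := μ) (r := r)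
    simp only [potential, combineBound]
    omega
  | boundsLoop μ r r' h =>
    obtain ⟨⟨hE, hsum⟩, hμ⟩ := hs
    obtain ⟨h1, h2, h3⟩ := h.invariant hE
    exact ⟨⟨⟨h1, h2.trans hsum⟩, hμ⟩, Nat.add_lt_add_left h3 _⟩
  | boundsFail μ r h hf =>
    obtain ⟨⟨hE, hsum⟩, hμ⟩ := hs
    refine ⟨?_, by simp only [potential]; omega⟩
    refine Set.eq_empty_iff_forall_notMem.2 fun p hp => ?_
    obtain ⟨h1, h2, h3⟩ := mem_EFb_iff.1 (hμ p hp)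
    exact not_feasible_of_boundsFail h hf h1 (h2.trans hsum.symm) h3
  | boundsExit μ r h ho =>
    obtain ⟨hE, hμ⟩ := hs
    refine ⟨⟨⟨hE, not_boundsGuard_iff.1 h⟩, hμ, ho⟩, ?_⟩
    have := raiseMinPotential_le (V := V) (b := b) (μ := μ) (F := ∅) (r := r)
    simp only [potential, fairBound, add_mul, mul_add]
    omega
  | boundsExitLeximin μ r h ho =>
    obtain ⟨hE, hμ⟩ := hs
    refine ⟨⟨⟨hE, not_boundsGuard_iff.1 h⟩, hμ, fun s _ _ j hj => absurd hj (notMem_empty j), ho⟩,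
      ?_⟩
    have := raiseMinPotential_le (V := V) (b := b) (μ := μ) (F := ∅) (r := r)
    simp only [potential, fairBound, compl_empty, Set.ncard_univ, Nat.card_eq_fintype_card,
      Nat.succ_mul]
    omega
  | maximinLoop μ r r' h =>
    obtain ⟨⟨⟨hE, hsum⟩, hb⟩, hμ, ho⟩ := hs
    obtain ⟨h1, h2, h3, -, -, h4⟩ := h.invariant hE hb
    exact ⟨⟨⟨⟨h1, h2.trans hsum⟩, h3⟩, hμ, ho⟩, Nat.add_lt_add_right h4 _⟩
  | maximinExit μ r h ho =>
    rw [blockedPoorest_empty] at h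
    have hg := h.resolve_right Set.not_nonempty_empty
    subst ho
    exact ⟨⟨hs.1, isMaximin_of_not_raiseMinGuard hs.2.1 hs.1 hg⟩, by simp only [potential]; omega⟩
  | maximinExitSpread μ r h ho =>
    rw [blockedPoorest_empty] at h
    exact ⟨⟨hs.1, hs.2.1, h.resolve_right Set.not_nonempty_empty, rfl, ho⟩,
      by simp only [potential]; omega⟩
  | leximinLoop μ r r' F h =>
    obtain ⟨⟨⟨hE, hsum⟩, hb⟩, hμ, hF, ho⟩ := hs
    obtain ⟨m, hm⟩ := poorest_nonempty (V := V) (σ := μ) (r := r) h.1.ne_univ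
    obtain ⟨h1, h2, h3, h4, h5, h6⟩ := h.invariant hE hb
    refine ⟨⟨⟨⟨h1, h2.trans hsum⟩, h3⟩, hμ, hF.step ?_ h4, ho⟩,
      Nat.add_lt_add_right (Nat.add_lt_add_left h6 _) _⟩
    exact sortedUtils_lt (fun j hj => (h4 j hj).symm) hm.1 fun j hj => h5 m hm j hj
  | leximinFreeze μ r F h hb =>
    obtain ⟨hE, hμ, hF, ho⟩ := hs
    refine ⟨⟨hE, hμ, hF.freeze, ho⟩, ?_⟩
    obtain ⟨m, hm⟩ := hb
    have hlt : (F ∪ blockedPoorest V noLower μ F r)ᶜ.ncard < Fᶜ.ncard :=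
      Set.ncard_lt_ncard ((Set.ssubset_iff_of_subset
        (Set.compl_subset_compl.2 subset_union_left)).2 ⟨m, hm.2.1, fun h => h (.inr hm)⟩)
        (Set.toFinite _)
    have h1 := raiseMinPotential_le (V := V) (b := b) (μ := μ)
      (F := F ∪ blockedPoorest V noLower μ F r) (r := r)
    -- A freeze may reset the move potential, which is at most `2 * Fintype.card R`; the weight lets
    -- one newly frozen room pay for this.
    have h2 := Nat.mul_le_mul_right (2 * Fintype.card R + 1) hlt
    simp only [potential]
    rw [Nat.succ_mul] at h2
    omega
  | leximinExit μ r F h =>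
    obtain ⟨hE, hμ, hF, rfl⟩ := hs
    exact ⟨⟨hE, isLeximin_of_fixed hμ hE hF h⟩, by simp only [potential]; omega⟩
  | minimaxLoop μ r r' F h =>
    -- After the maximin phase some richest room is blocked whenever the guard holds, so the second
    -- phase of min-spread never moves.
    exfalso
    obtain ⟨-, -, hg, rfl, -⟩ := hs
    obtain ⟨hL, hbl, -⟩ := h
    exact (blockedRichest_nonempty hg hL).ne_empty hbl
  | minimaxExit μ r F h =>
    obtain ⟨hE, hμ, hg, -, rfl⟩ := hs
    exact ⟨⟨hE, isMinAbsSpread_of_not_raiseMinGuard hμ hE hg,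
      isMinRelSpread_of_not_raiseMinGuard hμ hE hg⟩, by simp only [potential]; omega⟩

theorem exists_enter_step {σ : A ≃ R} {r : R → ℝ} {todo : Set (Set R)} {f : A → R}
    (h : Combined V b Rt σ r todo f) {C : Set R} (hC : C ∈ todo) :
    ∃ s', Step V b Rt o (.components σ todo f) s' := by
  classical
  obtain ⟨z, hz⟩ := nonempty_of_mem_components (h.subset hC)
  have : Nonempty {i : A // σ i ∈ C} := ⟨σ.symm z, by simpa using hz⟩
  -- Lowering the rents by the largest excess over a budget makes all budgets hold and the
  -- maximizing agent tight.
  obtain ⟨k, hk⟩ := Finite.exists_max fun i : {i : A // σ i ∈ C} => r (σ i) - b i (σ i)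
  set Δ := r (σ k) - b k (σ k) with hΔ
  have hE := h.envyFree.component C
  have hE' : EnvyFree (restrict V σ C) (restrictEquiv σ C) fun j => r j - Δ := by
    simpa only [sub_eq_add_neg] using hE.add_const (-Δ)
  refine ⟨_, .enter σ todo f C hC _ Δ (restrictEquiv σ C) (fun j => r j) ⟨hE, rfl⟩
    (mem_EFb_iff.2 ⟨hE', ?_, fun i => ?_⟩) ⟨k, ?_⟩⟩
  · simp [Finset.sum_sub_distrib]
  · have := hk i
    simp only [restrictEquiv_apply, restrict]
    linarith
  · simp only [Tight, restrictEquiv_apply, restrict, hΔ]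
    ring

/-- The algorithm does not get stuck. -/
theorem exists_step [Nonempty R] (hcard : Fintype.card A = Fintype.card R) {s : State A R}
    (hs : Invariant V b Rt o s) :
    (∃ s', Step V b Rt o s s') ∨ s = .noSolution ∨ ∃ μ r, s = .done μ r := by
  classical
  cases s with
  | start =>
    obtain ⟨σ, r, h⟩ := exists_envyFree hcard V
    exact .inl ⟨_, .init _ σ r ⟨h, rfl⟩⟩
  | components σ todo f =>
    left
    obtain ⟨r, hr⟩ := hs
    rcases todo.eq_empty_or_nonempty with rfl | ⟨C, hC⟩
    · let μ : A ≃ R := Equiv.ofBijective f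
        ((Fintype.bijective_iff_injective_and_card f).2 ⟨hr.injective, hcard⟩)
      have hμ : EnvyFree V μ r := fun i j =>
        (hr.envyFree i j).trans (hr.util_eq i).ge
      obtain ⟨s, hs⟩ := hμ.exists_total Rt
      exact ⟨_, .combine σ ∅ f μ s rfl (fun _ => rfl) hs⟩
    · exact exists_enter_step hr hC
  | maxRent σ todo f C ρ q =>
    left
    by_cases hg : MaxRentGuard (restrict V σ C) (restrict b σ C) ρ q
    · obtain ⟨r, hr, -⟩ := hs
      obtain ⟨z, hz⟩ := nonempty_of_mem_components (hr.subset (mem_insert C todo))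
      have : Nonempty {i : A // σ i ∈ C} := ⟨σ.symm z, by simpa using hz⟩
      obtain ⟨ρ', q', h⟩ := exists_maxRentStep hg
      exact ⟨_, .maxRentLoop σ todo f C ρ ρ' q q' h⟩
    · exact ⟨_, .maxRentExit σ todo f C ρ q hg⟩
  | bounds μ r =>
    left
    by_cases hg : BoundsGuard noLower (budgetUpper b μ) r
    · by_cases hf : BoundsFail V noLower (budgetUpper b μ) μ r
      · exact ⟨_, .boundsFail μ r hg hf⟩
      · obtain ⟨r', h⟩ := exists_boundsStep hs.1.1 hg hf
        exact ⟨_, .boundsLoop μ r r' h⟩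
    · cases o with
      | maximin => exact ⟨_, .boundsExit μ r hg (.inl rfl)⟩
      | leximin => exact ⟨_, .boundsExitLeximin μ r hg rfl⟩
      | minSpread => exact ⟨_, .boundsExit μ r hg (.inr rfl)⟩
  | maximin μ r =>
    left
    by_cases hg : RaiseMinGuard V (budgetUpper b μ) μ ∅ r
    · obtain ⟨r', h⟩ := exists_raiseMinStep hs.1.1.1 hg blockedPoorest_empty
      exact ⟨_, .maximinLoop μ r r' h⟩
    · rcases hs.2.2 with ho | ho
      · exact ⟨_, .maximinExit μ r (.inl hg) ho⟩
      · exact ⟨_, .maximinExitSpread μ r (.inl hg) ho⟩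
  | leximin μ r F =>
    left
    by_cases hg : RaiseMinGuard V (budgetUpper b μ) μ F r
    · rcases (blockedPoorest V noLower μ F r).eq_empty_or_nonempty with hb | hb
      · obtain ⟨r', h⟩ := exists_raiseMinStep hs.1.1.1 hg hb
        exact ⟨_, .leximinLoop μ r r' F h⟩
      · exact ⟨_, .leximinFreeze μ r F hg hb⟩
    · exact ⟨_, .leximinExit μ r F hg⟩
  | minimax μ r F =>
    left
    obtain ⟨-, -, hg, rfl, -⟩ := hs
    exact ⟨_, .minimaxExit μ r _ (imp_iff_not_or.1 (blockedRichest_nonempty hg))⟩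
  | noSolution => exact .inr (.inl rfl)
  | done μ r => exact .inr (.inr ⟨μ, r, rfl⟩)

theorem invariant_of_reachable [Nonempty R] {s : State A R}
    (h : Relation.ReflTransGen (Step V b Rt o) .start s) : Invariant V b Rt o s := by
  induction h with
  | refl => trivial
  | tail _ h ih => exact (h.invariant ih).1

/-- Bound on the steps of the algorithm for `n` rooms. -/
def stepBound (n : ℕ) : ℕ := n * (maxRentBound n + 2) + combineBound n + 1

theorem length_le_stepBound [Nonempty R] {k : ℕ} {run : ℕ → State A R} (h0 : run 0 = .start)
    (h : ∀ m < k, Step V b Rt o (run m) (run (m + 1))) : k ≤ stepBound (Fintype.card R) := by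
  have key : ∀ m ≤ k, Invariant V b Rt o (run m) ∧
      m + potential V b (run m) ≤ stepBound (Fintype.card R) := by
    intro m
    induction m with
    | zero =>
      intro _
      rw [h0]
      exact ⟨trivial, (Nat.zero_add _).le⟩
    | succ m ih =>
      intro hm
      obtain ⟨h1, h2⟩ := ih (Nat.le_of_succ_le hm)
      obtain ⟨h3, h4⟩ := (h m hm).invariant h1
      exact ⟨h3, by omega⟩
  exact (Nat.le_add_right _ _).trans (key k le_rfl).2

theorem exists_polynomial_stepBound : ∃ p : Polynomial ℕ, ∀ n, p.eval n = stepBound n := by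
  refine ⟨.X * (((.X + 1) * (.X * .X) + .X) + 2) +
    (((.X + 1) * (2 * .X + 1) + 2) + ((2 * .X + 1) * .X + 2 * .X) + 2) + 1, fun n => ?_⟩
  simp [stepBound, maxRentBound, combineBound, fairBound]

end Invariant

end RentDivision

end

theorem mainTheorem11 :
    ∃ p : Polynomial ℕ, ∀ (n : ℕ) (_hn : 0 < n) (V b : Fin n → Fin n → ℝ)
      (_hV : ∀ i j, 0 ≤ V i j) (Rt : ℝ) (o : RentDivision.Objective),
      -- every run has at most `p n` steps
      (∀ (k : ℕ) (run : ℕ → RentDivision.State (Fin n) (Fin n)),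
        run 0 = RentDivision.State.start →
        (∀ m < k, RentDivision.Step V b Rt o (run m) (run (m + 1))) → k ≤ p.eval n) ∧
      -- no run gets stuck before it has produced an output
      (∀ s, Relation.ReflTransGen (RentDivision.Step V b Rt o) RentDivision.State.start s →
        (∀ s', ¬ RentDivision.Step V b Rt o s s') →
        s = RentDivision.State.noSolution ∨ ∃ μ r, s = RentDivision.State.done μ r) ∧
      -- an allocation that is returned is feasible and optimal
      (∀ μ r, Relation.ReflTransGen (RentDivision.Step V b Rt o) RentDivision.State.start
          (RentDivision.State.done μ r) →
        (μ, r) ∈ RentDivision.EFb V b Rt ∧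
          o.IsOptimal V (RentDivision.EFb V b Rt) (μ, r)) ∧
      -- "No solution" is returned only if there is no feasible allocation
      (Relation.ReflTransGen (RentDivision.Step V b Rt o) RentDivision.State.start
          RentDivision.State.noSolution →
        RentDivision.EFb V b Rt = ∅) := by
  obtain ⟨p, hp⟩ := RentDivision.exists_polynomial_stepBound
  refine ⟨p, fun n hn V b _ Rt o => ?_⟩
  have hne : Nonempty (Fin n) := ⟨⟨0, hn⟩⟩
  refine ⟨fun k run h0 h => ?_, fun s hs hstuck => ?_, fun μ r h => ?_, fun h => ?_⟩
  · rw [hp]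
    simpa using RentDivision.length_le_stepBound h0 h
  · refine (RentDivision.exists_step rfl (RentDivision.invariant_of_reachable hs)).resolve_left ?_
    rintro ⟨s', h⟩
    exact hstuck s' h
  · exact RentDivision.invariant_of_reachable h
  · exact RentDivision.invariant_of_reachable h
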